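/- **Source category $\mathcal T^*$.** A *rooted simplicial tree* is a (small, not necessarily locally finite) simplicial tree with a chosen root vertex. It is identified with its geometric realization $(T,v)$ with the path metric for which each edge has length $1$. Write $B(v,r)$ for the open ball of radius $r$ around $v$. For $c\in T$ let $T_c=\{x\in T : c\in[v,x]\}$, where $[v,x]$ is the arc from $v$ to $x$. The objects of $\mathcal T^*$ are the rooted simplicial trees. Its morphisms $(T,v)\to(T',w)$ are the classes of continuous maps $f:T\to T'$ with $f(v)=w$ that are metrically proper (preimages of bounded sets are bounded), where $f$ and $f'$ are identified if there is a rooted metrically proper homotopy from $f$ to $f'$: a continuous $H:T\times[0,1]\to T'$ with $H(\cdot,0)=f$, $H(\cdot,1)=f'$, $H(v,t)=w$ for all $t$, and such that for all $M>0$ there is $N>0$ with $H^{-1}(B(w,M))\subseteq B(v,N)\times[0,1]$. **Target category Tower-Set.** Its objects are the inverse sequences $X_1\xleftarrow{p_1}X_2\xleftarrow{p_2}\cdots$ of (small) sets; write $p_{nm}:X_m\to X_n$ for the composite bonding maps ($n\le m$). A morphism of sequences $(X_n,p_n)\to(Y_n,q_n)$ is a pair $(f_n,\Phi)$ of a function $\Phi:\mathbb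 N\to\mathbb N$ and maps $f_n:X_{\Phi(n)}\to Y_n$ such that for all $n'>n$ there is $m\ge\Phi(n),\Phi(n')$ with $f_n\circ p_{\Phi(n)m}=q_{nn'}\circ f_{n'}\circ p_{\Phi(n')m}$. Two of them, $(f_n,\Phi)$ and $(g_n,\Psi)$, are equivalent if for each $n$ there is $m\ge\Phi(n),\Psi(n)$ with $f_n\circ p_{\Phi(n)m}=g_n\circ p_{\Psi(n)m}$. The morphisms of Tower-Set are the equivalence classes, with composition $(g_n,\Psi)\circ(f_n,\Phi)=(g_n\circ f_{\Psi(n)},\Phi\circ\Psi)$. **The functor $\eta:\mathcal T^*\to$ Tower-Set.** On objects, $\eta(T,v)=(C_1\leftarrow C_2\leftarrow\cdots)$, where $C_n$ is the set of vertices at distance $n$ from $v$ and $C_{n+1}\to C_n$ sends a vertex to its unique neighbour at distance $n$ from $v$. On morphisms, $\eta$ sends the class of $f:(T,v)\to(T',w)$ to the class of $(f_n,\Phi)$, where $\Phi$ is strictly increasing with $f^{-1}(B(w,n))\subseteq B(v,\Phi(n))$ for all $n$, and $f_n:C_{\Phi(n)}\to C'_n$ sends $c$ to the unique $c'\in C'_n$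 with $f(T_c)\subseteq T'_{c'}$. (The class does not depend on the choice of $\Phi$ or of $f$ in its class.) **Theorem.** The functor $\eta:\mathcal T^*\to$ Tower-Set is an equivalence of categories. -/

import Mathlib

open CategoryTheory Set Metric Topology

universe w u

/-! ## Inverse sequences and the category `Tower C` -/

/-- An inverse sequence in a category: an inverse system indexed by the natural numbers. The bonding
morphism `X m ⟶ X n` for `n ≤ m` is `X.p h`. -/
structure Tower (C : Type u) [Category.{w} C] where
  /-- The underlying inverse system. -/
  sys : ℕᵒᵖ ⥤ C

namespace Tower

variable {C : Type u} [Category.{w} C]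

/-- The `n`-th term of an inverse sequence. -/
abbrev X (X : Tower C) (n : ℕ) : C := X.sys.obj (Opposite.op n)

/-- The bonding morphism from the `m`-th to the `n`-th term, for `n ≤ m`. -/
abbrev p (X : Tower C) {n m : ℕ} (h : n ≤ m) : X.X m ⟶ X.X n := X.sys.map (homOfLE h).op

lemma p_comp (X : Tower C) {n m k : ℕ} (h : n ≤ m) (h' : m ≤ k) :
    X.p h' ≫ X.p h = X.p (h.trans h') := by
  rw [p, p, p, ← Functor.map_comp]
  rfl

lemma p_comp_assoc (X : Tower C) {n m k : ℕ} (h : n ≤ m) (h' : m ≤ k) {Z : C} (g : X.X n ⟶ Z) :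
    X.p h' ≫ X.p h ≫ g = X.p (h.trans h') ≫ g := by
  rw [← Category.assoc, p_comp]

lemma p_refl (X : Tower C) (n : ℕ) : X.p (le_refl n) = 𝟙 (X.X n) :=
  X.sys.map_id _

/-- A morphism of inverse sequences `(f_n, Φ)`: an index function `Φ` and morphisms
`f_n : X_{Φ n} ⟶ Y_n` that commute with the bonding morphisms after passing to a high enough
term of `X`. -/
structure SeqHom (X Y : Tower C) where
  /-- The index function. -/
  idx : ℕ → ℕ
  /-- The components. -/
  app : ∀ n, X.X (idx n) ⟶ Y.X n
  compat : ∀ {n n' : ℕ} (h : n ≤ n'), ∃ (m : ℕ) (h₁ : idx n ≤ m) (h₂ : idx n' ≤ m),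
    X.p h₁ ≫ app n = X.p h₂ ≫ app n' ≫ Y.p h

namespace SeqHom

variable {X Y Z : Tower C}

/-- The equivalence of morphisms of sequences: `(f_n, Φ) ∼ (g_n, Ψ)` if for each `n` the components
`f_n` and `g_n` agree after composition with the bonding morphisms from some `X_m`. -/
def Equivalent (f g : SeqHom X Y) : Prop :=
  ∀ n, ∃ (m : ℕ) (h₁ : f.idx n ≤ m) (h₂ : g.idx n ≤ m), X.p h₁ ≫ f.app n = X.p h₂ ≫ g.app n

lemma equivalence : Equivalence (Equivalent (X := X) (Y := Y)) where
  refl f n := ⟨_, le_rfl, le_rfl, rfl⟩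
  symm h n := by
    obtain ⟨m, h₁, h₂, e⟩ := h n
    exact ⟨m, h₂, h₁, e.symm⟩
  trans {f g k} h h' n := by
    obtain ⟨m, h₁, h₂, e⟩ := h n
    obtain ⟨m', h₁', h₂', e'⟩ := h' n
    refine ⟨max m m', h₁.trans (le_max_left _ _), h₂'.trans (le_max_right _ _), ?_⟩
    rw [← p_comp_assoc X h₁ (le_max_left m m'), e, p_comp_assoc,
      ← p_comp_assoc X h₂' (le_max_right m m'), ← e', p_comp_assoc]

instance setoid (X Y : Tower C) : Setoid (SeqHom X Y) := ⟨Equivalent, equivalence⟩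

/-- The identity morphism of sequences. -/
def id (X : Tower C) : SeqHom X X where
  idx n := n
  app n := 𝟙 _
  compat {n n'} h := ⟨n', h, le_rfl, by rw [Category.comp_id, Category.id_comp, p_comp]⟩

/-- The composite `(g_n ∘ f_{Ψ n}, Φ ∘ Ψ)` of `f = (f_n, Φ)` and `g = (g_n, Ψ)`. -/
def comp (f : SeqHom X Y) (g : SeqHom Y Z) : SeqHom X Z where
  idx n := f.idx (g.idx n)
  app n := f.app (g.idx n) ≫ g.app n
  compat {n n'} h := by
    obtain ⟨m, h₁, h₂, e⟩ := g.compat h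
    obtain ⟨k₁, a₁, b₁, e₁⟩ := f.compat h₁
    obtain ⟨k₂, a₂, b₂, e₂⟩ := f.compat h₂
    have hk₁ : k₁ ≤ max k₁ k₂ := le_max_left _ _
    have hk₂ : k₂ ≤ max k₁ k₂ := le_max_right _ _
    refine ⟨max k₁ k₂, a₁.trans hk₁, a₂.trans hk₂, ?_⟩
    have E₁ : X.p (a₁.trans hk₁) ≫ f.app (g.idx n) =
        X.p (b₁.trans hk₁) ≫ f.app m ≫ Y.p h₁ := by
      rw [← p_comp_assoc X a₁ hk₁, e₁, p_comp_assoc]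
    have E₂ : X.p (a₂.trans hk₂) ≫ f.app (g.idx n') =
        X.p (b₂.trans hk₂) ≫ f.app m ≫ Y.p h₂ := by
      rw [← p_comp_assoc X a₂ hk₂, e₂, p_comp_assoc]
    rw [← Category.assoc, E₁]
    simp only [Category.assoc]
    rw [e, ← Category.assoc (X.p (a₂.trans hk₂)), E₂]
    simp only [Category.assoc]

lemma comp_equivalent {f f' : SeqHom X Y} {g g' : SeqHom Y Z} (hf : Equivalent f f')
    (hg : Equivalent g g') : Equivalent (f.comp g) (f'.comp g') := by
  intro n
  obtain ⟨m, h₁, h₂, e⟩ := hg n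
  obtain ⟨k₁, a₁, b₁, e₁⟩ := f.compat h₁
  obtain ⟨k₂, a₂, b₂, e₂⟩ := f'.compat h₂
  obtain ⟨k₃, a₃, b₃, e₃⟩ := hf m
  obtain ⟨K, hK₁, hK₂, hK₃⟩ : ∃ K, k₁ ≤ K ∧ k₂ ≤ K ∧ k₃ ≤ K :=
    ⟨k₁ + k₂ + k₃, by lia, by lia, by lia⟩
  refine ⟨K, a₁.trans hK₁, a₂.trans hK₂, ?_⟩
  change X.p _ ≫ f.app _ ≫ g.app n = X.p _ ≫ f'.app _ ≫ g'.app n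
  have E₁ : X.p (a₁.trans hK₁) ≫ f.app (g.idx n) = X.p (b₁.trans hK₁) ≫ f.app m ≫ Y.p h₁ := by
    rw [← p_comp_assoc X a₁ hK₁, e₁, p_comp_assoc]
  have E₂ : X.p (a₂.trans hK₂) ≫ f'.app (g'.idx n) = X.p (b₂.trans hK₂) ≫ f'.app m ≫ Y.p h₂ := by
    rw [← p_comp_assoc X a₂ hK₂, e₂, p_comp_assoc]
  have E₃ : X.p (a₃.trans hK₃) ≫ f.app m = X.p (b₃.trans hK₃) ≫ f'.app m := by
    rw [← p_comp_assoc X a₃ hK₃, e₃, p_comp_assoc]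
  rw [← Category.assoc, E₁, ← Category.assoc (X.p (a₂.trans hK₂)), E₂]
  simp only [Category.assoc]
  rw [e, ← Category.assoc (X.p (b₁.trans hK₁)), E₃]
  simp only [Category.assoc]

end SeqHom

/-- The category of inverse sequences, with equivalence classes of morphisms of sequences. For
`C = Type u` this is the category `Tower-Set`. -/
instance category : Category (Tower C) where
  Hom X Y := Quotient (SeqHom.setoid X Y)
  id X := Quotient.mk _ (SeqHom.id X)
  comp := Quotient.map₂ SeqHom.comp fun _ _ hf _ _ hg => SeqHom.comp_equivalent hf hg
  id_comp := by
    rintro X Y ⟨f⟩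
    refine Quotient.sound fun n => ⟨_, le_rfl, le_rfl, ?_⟩
    change X.p _ ≫ 𝟙 _ ≫ f.app n = _
    rw [Category.id_comp]
  comp_id := by
    rintro X Y ⟨f⟩
    refine Quotient.sound fun n => ⟨_, le_rfl, le_rfl, ?_⟩
    change X.p _ ≫ f.app n ≫ 𝟙 _ = _
    rw [Category.comp_id]
  assoc := by
    rintro X Y Z W ⟨f⟩ ⟨g⟩ ⟨h⟩
    refine Quotient.sound fun n => ⟨_, le_rfl, le_rfl, ?_⟩
    change X.p _ ≫ (f.app _ ≫ g.app _) ≫ h.app n = X.p _ ≫ f.app _ ≫ g.app _ ≫ h.app n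
    rw [Category.assoc]

end Tower

/-! ## Rooted simplicial trees -/

/-- A rooted simplicial tree, given by its graph of vertices and edges and its root. -/
structure SimplicialTree where
  /-- The vertices. -/
  V : Type u
  /-- The graph formed by the vertices and the edges. -/
  graph : SimpleGraph V
  isTree : graph.IsTree
  /-- The root. -/
  root : V

namespace SimplicialTree

variable (T : SimplicialTree.{u})

/-- The (combinatorial) distance of a vertex from the root. -/
noncomputable def depth (c : T.V) : ℕ := T.graph.dist T.root c

lemma depth_root : T.depth T.root = 0 := SimpleGraph.dist_self

lemma depth_eq_zero {c : T.V} : T.depth c = 0 ↔ c = T.root := by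
  rw [depth, T.isTree.connected.dist_eq_zero_iff, eq_comm]

lemma depth_adj {a b : T.V} (h : T.graph.Adj a b) :
    T.depth a = T.depth b + 1 ∨ T.depth b = T.depth a + 1 :=
  T.isTree.dist_eq_dist_add_one_of_adj T.root h

/-- A vertex other than the root has exactly one neighbour that is nearer to the root. -/
lemma existsUnique_parent {c : T.V} (hc : c ≠ T.root) :
    ∃! b, T.graph.Adj c b ∧ T.depth b + 1 = T.depth c := by
  obtain ⟨q, hq, hql⟩ := T.isTree.connected.exists_path_of_dist T.root c
  have key : ∀ b, T.graph.Adj c b → T.depth b + 1 = T.depth c → b = q.penultimate := by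
    intro b hb hd
    obtain ⟨r, hr, hrl⟩ := T.isTree.connected.exists_path_of_dist T.root b
    have hcr : c ∉ r.support := by
      intro hcr
      classical
      have h1 := SimpleGraph.dist_le (r.takeUntil c hcr)
      have h2 := r.length_takeUntil_le_length hcr
      unfold depth at hd
      lia
    have hbq : b ∈ q.support :=
      T.isTree.isAcyclic.mem_support_of_ne_mem_support_of_adj_of_isPath hq hr hb hcr
    exact T.isTree.isAcyclic.eq_penultimate_of_adj_end hq hb hbq
  have hn : ¬ q.Nil := fun h => hc h.eq.symm
  have hadj : T.graph.Adj c q.penultimate := (q.adj_penultimate hn).symm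
  refine ⟨q.penultimate, ⟨hadj, ?_⟩, fun b hb => key b hb.1 hb.2⟩
  have h1 : T.depth q.penultimate ≤ q.length - 1 := by
    have := SimpleGraph.dist_le q.dropLast
    simpa [depth] using this
  have h2 : q.length = T.depth c := hql
  rcases T.depth_adj hadj with h | h <;> lia

open Classical in
/-- The parent of a vertex: its unique neighbour that is nearer to the root. (The parent of the root
is the root, by convention.) -/
noncomputable def parent (c : T.V) : T.V :=
  if h : c = T.root then T.root else (T.existsUnique_parent h).choose

lemma parent_spec {c : T.V} (h : c ≠ T.root) :
    T.graph.Adj c (T.parent c) ∧ T.depth (T.parent c) + 1 = T.depth c := by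
  rw [parent, dif_neg h]
  exact (T.existsUnique_parent h).choose_spec.1

lemma parent_eq {c b : T.V} (hb : T.graph.Adj c b) (hd : T.depth b + 1 = T.depth c) :
    T.parent c = b := by
  have hc : c ≠ T.root := fun h => by
    rw [h, depth_root] at hd
    lia
  exact (T.existsUnique_parent hc).unique (T.parent_spec hc) ⟨hb, hd⟩

lemma depth_parent (c : T.V) : T.depth (T.parent c) = T.depth c - 1 := by
  by_cases h : c = T.root
  · rw [parent, dif_pos h, h, depth_root]
  · have := (T.parent_spec h).2
    lia

/-- The ancestor at distance `k` from the root (the vertex itself if its depth is at most `k`). -/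
noncomputable def anc (k : ℕ) (c : T.V) : T.V := T.parent^[T.depth c - k] c

lemma depth_iterate (c : T.V) (j : ℕ) : T.depth (T.parent^[j] c) = T.depth c - j := by
  induction j with
  | zero => rfl
  | succ j ih =>
    rw [Function.iterate_succ_apply', depth_parent, ih]
    lia

lemma depth_anc {k : ℕ} {c : T.V} (h : k ≤ T.depth c) : T.depth (T.anc k c) = k := by
  rw [anc, depth_iterate]
  lia

lemma anc_self (c : T.V) : T.anc (T.depth c) c = c := by
  rw [anc, Nat.sub_self, Function.iterate_zero, _root_.id]

lemma anc_anc {k l : ℕ} (c : T.V) (hkl : k ≤ l) (hl : l ≤ T.depth c) :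
    T.anc k (T.anc l c) = T.anc k c := by
  conv_lhs => rw [anc, depth_anc T hl, anc, ← Function.iterate_add_apply]
  rw [anc]
  congr 2
  lia

lemma anc_parent {k : ℕ} {c : T.V} (h : k < T.depth c) : T.anc k (T.parent c) = T.anc k c := by
  rw [anc, anc, depth_parent, ← Function.iterate_succ_apply]
  congr 2
  lia

open Classical in
/-- The depth of the last common ancestor of two vertices. -/
noncomputable def meet (a b : T.V) : ℕ :=
  Nat.findGreatest (fun k => T.anc k a = T.anc k b) (min (T.depth a) (T.depth b))

lemma anc_zero (a : T.V) : T.anc 0 a = T.root := by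
  rw [← depth_eq_zero, depth_anc T (Nat.zero_le _)]

lemma le_meet_iff {a b : T.V} {k : ℕ} (ha : k ≤ T.depth a) (hb : k ≤ T.depth b) :
    k ≤ T.meet a b ↔ T.anc k a = T.anc k b := by
  classical
  constructor
  · intro h
    have hm : T.anc (T.meet a b) a = T.anc (T.meet a b) b :=
      Nat.findGreatest_spec (P := fun k => T.anc k a = T.anc k b) (Nat.zero_le _)
        (by simp only [anc_zero])
    have hle : T.meet a b ≤ min (T.depth a) (T.depth b) := Nat.findGreatest_le _
    rw [← T.anc_anc a h (hle.trans (min_le_left _ _)), hm,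
      T.anc_anc b h (hle.trans (min_le_right _ _))]
  · intro h
    exact Nat.le_findGreatest (le_min ha hb) h

lemma meet_le_left (a b : T.V) : T.meet a b ≤ T.depth a :=
  by classical exact (Nat.findGreatest_le _).trans (min_le_left _ _)

lemma meet_le_right (a b : T.V) : T.meet a b ≤ T.depth b :=
  by classical exact (Nat.findGreatest_le _).trans (min_le_right _ _)

lemma meet_self (a : T.V) : T.meet a a = T.depth a :=
  le_antisymm (T.meet_le_left a a) ((T.le_meet_iff le_rfl le_rfl).2 rfl)

lemma meet_comm (a b : T.V) : T.meet a b = T.meet b a := by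
  apply le_antisymm
  · rw [T.le_meet_iff (T.meet_le_right a b) (T.meet_le_left a b), eq_comm,
      ← T.le_meet_iff (T.meet_le_left a b) (T.meet_le_right a b)]
  · rw [T.le_meet_iff (T.meet_le_right b a) (T.meet_le_left b a), eq_comm,
      ← T.le_meet_iff (T.meet_le_left b a) (T.meet_le_right b a)]

lemma min_meet_le (a b c : T.V) : min (T.meet a b) (T.meet b c) ≤ T.meet a c := by
  have h1 := min_le_left (T.meet a b) (T.meet b c)
  have h2 := min_le_right (T.meet a b) (T.meet b c)
  have ha := h1.trans (T.meet_le_left a b)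
  have hb := h1.trans (T.meet_le_right a b)
  have hc := h2.trans (T.meet_le_right b c)
  exact (T.le_meet_iff ha hc).2
    (((T.le_meet_iff ha hb).1 h1).trans ((T.le_meet_iff hb hc).1 h2))

lemma meet_parent (a b : T.V) :
    T.meet (T.parent a) b = min (T.meet a b) (T.depth a - 1) := by
  by_cases ha : a = T.root
  · have : T.parent a = T.root := by rw [parent, dif_pos ha]
    have h0 : T.depth a = 0 := by rw [ha, depth_root]
    have h1 := T.meet_le_left (T.parent a) b
    rw [this, depth_root] at h1
    rw [this]
    lia
  have hd := T.depth_parent a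
  have hpos : 0 < T.depth a := Nat.pos_of_ne_zero fun h => ha (T.depth_eq_zero.1 h)
  apply le_antisymm
  · have h1 := T.meet_le_left (T.parent a) b
    have h2 := T.meet_le_right (T.parent a) b
    refine le_min ?_ (by lia)
    rw [T.le_meet_iff (by lia) h2, ← T.anc_parent (by lia), ← T.le_meet_iff h1 h2]
  · have h1 := min_le_left (T.meet a b) (T.depth a - 1)
    have h2 := min_le_right (T.meet a b) (T.depth a - 1)
    have h3 := h1.trans (T.meet_le_right a b)
    rw [T.le_meet_iff (by lia) h3, T.anc_parent (by lia), ← T.le_meet_iff (by lia) h3]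
    exact h1

lemma dist_parent_iterate (c : T.V) (j : ℕ) : T.graph.dist c (T.parent^[j] c) ≤ j := by
  induction j with
  | zero => simp
  | succ j ih =>
    rw [Function.iterate_succ_apply']
    have h := T.isTree.connected.dist_triangle (u := c) (v := T.parent^[j] c)
      (w := T.parent (T.parent^[j] c))
    have h' : T.graph.dist (T.parent^[j] c) (T.parent (T.parent^[j] c)) ≤ 1 := by
      by_cases hr : T.parent^[j] c = T.root
      · have : T.parent (T.parent^[j] c) = T.root := by rw [parent, dif_pos hr]
        rw [this, hr]
        simp
      · exact (SimpleGraph.dist_eq_one_iff_adj.2 (T.parent_spec hr).1).le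
    lia

/-- Distances in a tree, in terms of the depth of the last common ancestor. -/
lemma dist_add_meet (a b : T.V) :
    T.graph.dist a b + 2 * T.meet a b = T.depth a + T.depth b := by
  have hla := T.meet_le_left a b
  have hlb := T.meet_le_right a b
  have upper : T.graph.dist a b + 2 * T.meet a b ≤ T.depth a + T.depth b := by
    have h := T.isTree.connected.dist_triangle (u := a) (v := T.anc (T.meet a b) a) (w := b)
    have h1 := T.dist_parent_iterate a (T.depth a - T.meet a b)
    have h2 := T.dist_parent_iterate b (T.depth b - T.meet a b)
    change T.graph.dist a (T.anc (T.meet a b) a) ≤ _ at h1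
    change T.graph.dist b (T.anc (T.meet a b) b) ≤ _ at h2
    rw [← (T.le_meet_iff hla hlb).1 le_rfl, SimpleGraph.dist_comm] at h2
    lia
  have step : ∀ {x y : T.V}, T.graph.Adj x y →
      T.depth x + 2 * T.meet y b ≤ T.depth y + 2 * T.meet x b + 1 := by
    intro x y h
    rcases T.depth_adj h with hd | hd
    · have := T.meet_parent x b
      rw [T.parent_eq h hd.symm] at this
      lia
    · have := T.meet_parent y b
      have hy := T.meet_le_left y b
      rw [T.parent_eq h.symm hd.symm] at this
      lia
  have lower : ∀ {x y : T.V} (q : T.graph.Walk x y), y = b →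
      T.depth x + T.depth b ≤ q.length + 2 * T.meet x b := by
    intro x y q
    induction q with
    | nil =>
      rintro rfl
      rw [meet_self]
      simp
      lia
    | cons h q ih =>
      intro e
      have h1 := ih e
      have h2 := step h
      rw [SimpleGraph.Walk.length_cons]
      lia
  obtain ⟨q, hq⟩ := T.isTree.connected.exists_walk_length_eq_dist a b
  have := lower q rfl
  lia

/-- The Gromov product of two vertices with respect to the root, in terms of the graph distance: the
length of the common part of the paths that join the root to the two vertices. -/
noncomputable def gromov (a b : T.V) : ℝ :=
  ((T.graph.dist T.root a : ℝ) + T.graph.dist T.root b - T.graph.dist a b) / 2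

lemma gromov_eq_meet (a b : T.V) : T.gromov a b = T.meet a b := by
  have h : (T.graph.dist a b : ℝ) + 2 * T.meet a b = T.graph.dist T.root a + T.graph.dist T.root b :=
    mod_cast T.dist_add_meet a b
  rw [gromov]
  linarith

/-- The points of the geometric realization of a rooted tree in which each edge is an interval of
length one. A point at distance `t` from the root lies on the path from the root to a vertex `c` at
distance `⌈t⌉` from the root (`c` is the point itself if `t` is an integer, and otherwise the far end
of the edge that contains the point), and it is determined by `c` and `t`. -/
@[ext]
structure Pt where
  /-- The far end `c` of the edge that contains the point, or the point itself if it is a vertex. -/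
  vertex : T.V
  /-- The distance `t` from the root. -/
  height : ℝ
  height_nonneg : 0 ≤ height
  dist_eq_ceil : T.graph.dist T.root vertex = ⌈height⌉₊

namespace Pt

variable {T}

lemma height_le (x : T.Pt) : x.height ≤ T.depth x.vertex := by
  rw [depth, x.dist_eq_ceil]
  exact Nat.le_ceil _

lemma le_depth (x : T.Pt) {n : ℕ} (h : (n : ℝ) ≤ x.height) : n ≤ T.depth x.vertex := by
  exact_mod_cast h.trans x.height_le

/-- The length of the common part of the paths from the root to two points. -/
noncomputable def common (x y : T.Pt) : ℝ :=
  min (min x.height y.height) (T.gromov x.vertex y.vertex)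

lemma common_comm (x y : T.Pt) : common x y = common y x := by
  rw [common, common, gromov_eq_meet, gromov_eq_meet, meet_comm, min_comm x.height]

lemma common_le_left (x y : T.Pt) : common x y ≤ x.height :=
  (min_le_left _ _).trans (min_le_left _ _)

lemma common_le_right (x y : T.Pt) : common x y ≤ y.height :=
  (min_le_left _ _).trans (min_le_right _ _)

lemma min_common_le (x y z : T.Pt) : min (common x y) (common y z) ≤ common x z := by
  have h : (min (T.meet x.vertex y.vertex : ℝ) (T.meet y.vertex z.vertex)) ≤
      T.meet x.vertex z.vertex := mod_cast T.min_meet_le x.vertex y.vertex z.vertex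
  simp only [common, gromov_eq_meet]
  refine le_min (le_min ?_ ?_) (le_trans ?_ h)
  · exact (min_le_left _ _).trans ((min_le_left _ _).trans (min_le_left _ _))
  · exact (min_le_right _ _).trans ((min_le_left _ _).trans (min_le_right _ _))
  · exact min_le_min (min_le_right _ _) (min_le_right _ _)

lemma common_self (x : T.Pt) : common x x = x.height := by
  rw [common, gromov_eq_meet, meet_self, min_self, min_eq_left x.height_le]

/-- The path metric of the geometric realization: the arc that joins `x` and `y` leaves and reaches
the paths from the root to `x` and `y` at the end of their common part. -/
noncomputable instance : MetricSpace T.Pt where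
  dist x y := x.height + y.height - 2 * common x y
  dist_self x := by
    rw [common_self]
    ring
  dist_comm x y := by
    rw [common_comm]
    ring
  dist_triangle x y z := by
    have h1 := common_le_right x y
    have h2 := common_le_left y z
    have h3 := min_common_le x y z
    rcases min_le_iff.1 h3 with h | h <;> linarith
  eq_of_dist_eq_zero {x y} h := by
    have h1 := common_le_left x y
    have h2 := common_le_right x y
    have hx : x.height = common x y := by linarith
    have hy : y.height = common x y := by linarith
    have hxy : x.height = y.height := hx.trans hy.symm
    have hm : x.height ≤ T.meet x.vertex y.vertex := by
      rw [hx, ← gromov_eq_meet]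
      exact min_le_right _ _
    have hd : T.depth x.vertex = T.depth y.vertex := by
      rw [depth, depth, x.dist_eq_ceil, y.dist_eq_ceil, hxy]
    have hm' : T.depth x.vertex ≤ T.meet x.vertex y.vertex := by
      rw [depth, x.dist_eq_ceil]
      exact Nat.ceil_le.2 hm
    have hv := (T.le_meet_iff le_rfl hd.le).1 hm'
    rw [anc_self, hd, anc_self] at hv
    exact Pt.ext hv hxy

lemma dist_def (x y : T.Pt) : dist x y = x.height + y.height - 2 * common x y := rfl

/-- A vertex, as a point of the geometric realization. -/
noncomputable def ofVertex (c : T.V) : T.Pt where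
  vertex := c
  height := T.graph.dist T.root c
  height_nonneg := Nat.cast_nonneg _
  dist_eq_ceil := (Nat.ceil_natCast _).symm

/-- The metric extends the graph distance of the vertices. -/
lemma dist_ofVertex (a b : T.V) : dist (ofVertex a) (ofVertex b) = T.graph.dist a b := by
  have ha : (T.meet a b : ℝ) ≤ T.graph.dist T.root a := mod_cast T.meet_le_left a b
  have hb : (T.meet a b : ℝ) ≤ T.graph.dist T.root b := mod_cast T.meet_le_right a b
  have h : common (ofVertex a) (ofVertex b) = T.meet a b := by
    rw [common, gromov_eq_meet]
    exact min_eq_right (le_min ha hb)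
  have h' := T.gromov_eq_meet a b
  rw [gromov] at h'
  rw [dist_def, h]
  simp only [ofVertex]
  linarith

variable (T) in
/-- The root, as a point of the geometric realization. -/
noncomputable def root : T.Pt := ofVertex T.root

lemma dist_root (x : T.Pt) : dist (root T) x = x.height := by
  have h0 : (root T).height = 0 := by
    simp [root, ofVertex]
  have h1 : common (root T) x ≤ 0 := (common_le_left _ _).trans h0.le
  have h2 : 0 ≤ common (root T) x := by
    rw [common, gromov_eq_meet, h0]
    exact le_min (le_min le_rfl x.height_nonneg) (Nat.cast_nonneg _)
  rw [dist_def, h0]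
  linarith

lemma mem_ball_root {x : T.Pt} {r : ℝ} : x ∈ ball (root T) r ↔ x.height < r := by
  rw [mem_ball, dist_comm, dist_root]

/-- The point at height `t` on the path from the root to a vertex. -/
noncomputable def onPath (a : T.V) (t : ℝ) (h0 : 0 ≤ t) (h1 : t ≤ T.depth a) : T.Pt where
  vertex := T.anc ⌈t⌉₊ a
  height := t
  height_nonneg := h0
  dist_eq_ceil := T.depth_anc (Nat.ceil_le.2 h1)

lemma dist_onPath (a : T.V) {s t : ℝ} (hs hs' ht ht') :
    dist (onPath a s hs hs') (onPath a t ht ht') = |s - t| := by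
  have hs2 : ⌈s⌉₊ ≤ T.depth a := Nat.ceil_le.2 hs'
  have ht2 : ⌈t⌉₊ ≤ T.depth a := Nat.ceil_le.2 ht'
  have hm : min ⌈s⌉₊ ⌈t⌉₊ ≤ T.meet (T.anc ⌈s⌉₊ a) (T.anc ⌈t⌉₊ a) := by
    rw [T.le_meet_iff (by rw [T.depth_anc hs2]; exact min_le_left _ _)
      (by rw [T.depth_anc ht2]; exact min_le_right _ _),
      T.anc_anc a (min_le_left _ _) hs2, T.anc_anc a (min_le_right _ _) ht2]
  have hm' : min s t ≤ T.meet (T.anc ⌈s⌉₊ a) (T.anc ⌈t⌉₊ a) := by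
    refine (min_le_min (Nat.le_ceil s) (Nat.le_ceil t)).trans ?_
    exact_mod_cast hm
  have hc : common (onPath a s hs hs') (onPath a t ht ht') = min s t := by
    rw [common, gromov_eq_meet]
    exact min_eq_left hm'
  rw [dist_def, hc]
  change s + t - 2 * min s t = _
  rcases le_total s t with h | h
  · rw [min_eq_left h, abs_of_nonpos (by linarith)]
    ring
  · rw [min_eq_right h, abs_of_nonneg (by linarith)]
    ring

lemma onPath_vertex (x : T.Pt) : onPath x.vertex x.height x.height_nonneg x.height_le = x := by
  refine Pt.ext ?_ rfl
  change T.anc ⌈x.height⌉₊ x.vertex = x.vertex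
  rw [← x.dist_eq_ceil]
  exact T.anc_self _

/-- The subtree `T_c` determined by a point `c`: the points `x` for which `c` lies on the arc from the
root to `x`. -/
def subtree (c : T.Pt) : Set T.Pt :=
  {x | dist (root T) c + dist c x = dist (root T) x}

lemma mem_subtree_ofVertex {c : T.V} {x : T.Pt} :
    x ∈ subtree (ofVertex c) ↔ (T.depth c : ℝ) ≤ x.height ∧ T.anc (T.depth c) x.vertex = c := by
  have h0 : (ofVertex c).height = T.depth c := rfl
  have key : x ∈ subtree (ofVertex c) ↔ (T.depth c : ℝ) ≤ common (ofVertex c) x := by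
    rw [subtree, mem_ofPred_eq, dist_root, dist_root, dist_def, h0]
    have := common_le_left (ofVertex c) x
    rw [h0] at this
    constructor <;> intro h <;> linarith
  rw [key, common, gromov_eq_meet, le_min_iff, le_min_iff, h0]
  constructor
  · rintro ⟨⟨-, h1⟩, h2⟩
    refine ⟨h1, ?_⟩
    have := (T.le_meet_iff le_rfl (x.le_depth h1)).1 (Nat.cast_le.1 h2)
    rw [← this]
    exact T.anc_self c
  · rintro ⟨h1, h2⟩
    refine ⟨⟨le_rfl, h1⟩, Nat.cast_le.2 ((T.le_meet_iff le_rfl (x.le_depth h1)).2 ?_)⟩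
    rw [h2]
    exact T.anc_self c

lemma isPreconnected_subtree (c : T.V) : IsPreconnected (subtree (ofVertex c)) := by
  refine isPreconnected_of_forall (ofVertex c) fun x hx => ?_
  obtain ⟨h1, h2⟩ := mem_subtree_ofVertex.1 hx
  have hd : (0 : ℝ) ≤ T.depth c := Nat.cast_nonneg _
  let γ : Icc (T.depth c : ℝ) x.height → T.Pt := fun s =>
    onPath x.vertex s (hd.trans s.2.1) (s.2.2.trans x.height_le)
  have hγ : Continuous γ := (Isometry.of_dist_eq fun s t => by
    rw [dist_onPath]
    rfl).continuous
  have : PreconnectedSpace (Icc (T.depth c : ℝ) x.height) :=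
    Subtype.preconnectedSpace isPreconnected_Icc
  refine ⟨range γ, ?_, ⟨⟨_, left_mem_Icc.2 h1⟩, ?_⟩, ⟨⟨_, right_mem_Icc.2 h1⟩, onPath_vertex x⟩,
    isPreconnected_range hγ⟩
  · rintro _ ⟨s, rfl⟩
    rw [mem_subtree_ofVertex]
    refine ⟨s.2.1, ?_⟩
    change T.anc (T.depth c) (T.anc ⌈(s : ℝ)⌉₊ x.vertex) = c
    rw [T.anc_anc _ (Nat.cast_le.1 (s.2.1.trans (Nat.le_ceil _)))
      (Nat.ceil_le.2 (s.2.2.trans x.height_le)), h2]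
  · refine Pt.ext ?_ rfl
    change T.anc ⌈(T.depth c : ℝ)⌉₊ x.vertex = c
    rw [Nat.ceil_natCast, h2]

/-- On a preconnected set that misses the open ball of radius `n` around the root, all points have the
same ancestor at distance `n` from the root. -/
lemma anc_eq_of_isPreconnected {s : Set T.Pt} (hs : IsPreconnected s) {n : ℕ}
    (hn : ∀ x ∈ s, (n : ℝ) ≤ x.height) {x y : T.Pt} (hx : x ∈ s) (hy : y ∈ s) :
    T.anc n x.vertex = T.anc n y.vertex := by
  refine hs.induction₂' (fun x y => T.anc n x.vertex = T.anc n y.vertex) (fun x hx => ?_)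
    (fun x y z _ _ _ h h' => h.trans h') hx hy
  have hball : ball x 1 ∈ 𝓝[s] x := mem_nhdsWithin_of_mem_nhds (ball_mem_nhds x one_pos)
  filter_upwards [hball, self_mem_nhdsWithin] with y hxy hy
  have hX := hn x hx
  have hY := hn y hy
  rw [mem_ball, dist_comm, dist_def] at hxy
  have h1 : common x y ≤ T.meet x.vertex y.vertex := by
    rw [common, gromov_eq_meet]
    exact min_le_right _ _
  have h2 : (n : ℝ) < (T.meet x.vertex y.vertex : ℝ) + 1 := by linarith
  have h3 : n ≤ T.meet x.vertex y.vertex := Nat.lt_succ_iff.1 (by exact_mod_cast h2)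
  have h4 := (T.le_meet_iff (x.le_depth hX) (y.le_depth hY)).1 h3
  exact ⟨h4, h4.symm⟩

end Pt

/-! ## Metrically proper maps and homotopies -/

/-- A rooted continuous metrically proper map between (realizations of) rooted trees: the preimage of
each bounded set is bounded. -/
structure ProperMap (S T : SimplicialTree.{u}) where
  /-- The underlying continuous map. -/
  toMap : C(S.Pt, T.Pt)
  map_root : toMap (Pt.root S) = Pt.root T
  proper : ∀ A : Set T.Pt, Bornology.IsBounded A → Bornology.IsBounded (toMap ⁻¹' A)

namespace ProperMap

variable {S T U : SimplicialTree.{u}}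

lemma exists_ball (f : ProperMap S T) (M : ℝ) :
    ∃ N > 0, f.toMap ⁻¹' ball (Pt.root T) M ⊆ ball (Pt.root S) N := by
  obtain ⟨r, hr⟩ := (f.proper _ (isBounded_ball (x := Pt.root T) (r := M))).subset_ball
    (Pt.root S)
  exact ⟨max r 1, lt_max_of_lt_right one_pos, hr.trans (ball_subset_ball (le_max_left _ _))⟩

/-- The identity map. -/
noncomputable def id (S : SimplicialTree.{u}) : ProperMap S S := ⟨ContinuousMap.id _, rfl, fun _ h => h⟩

/-- The composite of two maps. -/
noncomputable def comp (f : ProperMap S T) (g : ProperMap T U) : ProperMap S U where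
  toMap := g.toMap.comp f.toMap
  map_root := by rw [ContinuousMap.comp_apply, f.map_root, g.map_root]
  proper A hA := f.proper _ (g.proper A hA)

/-- A homotopy `H` between maps of rooted trees is a rooted metrically proper homotopy if it keeps the
root fixed and for each `M > 0` there is `N > 0` with `H⁻¹(B(w, M)) ⊆ B(v, N) × I`. -/
def IsProperHomotopy {f g : ProperMap S T} (H : ContinuousMap.Homotopy f.toMap g.toMap) : Prop :=
  (∀ t, H (t, Pt.root S) = Pt.root T) ∧
    ∀ M : ℝ, 0 < M → ∃ N : ℝ, 0 < N ∧
      ∀ t x, H (t, x) ∈ ball (Pt.root T) M → x ∈ ball (Pt.root S) N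

/-- `f` and `g` are homotopic by a rooted metrically proper homotopy. -/
def Homotopic (f g : ProperMap S T) : Prop :=
  ∃ H : ContinuousMap.Homotopy f.toMap g.toMap, IsProperHomotopy H

lemma homotopic_equivalence : Equivalence (Homotopic (S := S) (T := T)) where
  refl f := by
    refine ⟨ContinuousMap.Homotopy.refl _, fun t => f.map_root, fun M _ => ?_⟩
    obtain ⟨N, hN, h⟩ := f.exists_ball M
    exact ⟨N, hN, fun t x hx => h hx⟩
  symm := by
    rintro f g ⟨H, h0, h1⟩
    refine ⟨H.symm, fun t => h0 _, fun M hM => ?_⟩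
    obtain ⟨N, hN, h⟩ := h1 M hM
    exact ⟨N, hN, fun t x hx => h _ x hx⟩
  trans := by
    rintro f g k ⟨H, h0, h1⟩ ⟨K, k0, k1⟩
    refine ⟨H.trans K, fun t => ?_, fun M hM => ?_⟩
    · rw [ContinuousMap.Homotopy.trans_apply]
      split_ifs
      · exact h0 _
      · exact k0 _
    · obtain ⟨N, hN, h⟩ := h1 M hM
      obtain ⟨N', hN', h'⟩ := k1 M hM
      refine ⟨max N N', lt_max_of_lt_left hN, fun t x hx => ?_⟩
      rw [ContinuousMap.Homotopy.trans_apply] at hx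
      split_ifs at hx
      · exact ball_subset_ball (le_max_left _ _) (h _ x hx)
      · exact ball_subset_ball (le_max_right _ _) (h' _ x hx)

instance setoid (S T : SimplicialTree.{u}) : Setoid (ProperMap S T) := ⟨Homotopic, homotopic_equivalence⟩

lemma comp_homotopic {f f' : ProperMap S T} {g g' : ProperMap T U} (hf : Homotopic f f')
    (hg : Homotopic g g') : Homotopic (f.comp g) (f'.comp g') := by
  obtain ⟨H, h0, h1⟩ := hf
  obtain ⟨K, k0, k1⟩ := hg
  refine homotopic_equivalence.trans (y := f.comp g') ?_ ?_
  · refine ⟨K.comp (ContinuousMap.Homotopy.refl f.toMap), fun t => ?_, fun M hM => ?_⟩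
    · change K (t, f.toMap (Pt.root S)) = _
      rw [f.map_root, k0]
    · obtain ⟨N, -, h⟩ := k1 M hM
      obtain ⟨N', hN', h'⟩ := f.exists_ball N
      exact ⟨N', hN', fun t x hx => h' (h t _ hx)⟩
  · refine ⟨(ContinuousMap.Homotopy.refl g'.toMap).comp H, fun t => ?_, fun M hM => ?_⟩
    · change g'.toMap (H (t, Pt.root S)) = _
      rw [h0, g'.map_root]
    · obtain ⟨N, hN, h⟩ := g'.exists_ball M
      obtain ⟨N', hN', h'⟩ := h1 N hN
      exact ⟨N', hN', fun t x hx => h' t x (h hx)⟩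

end ProperMap

/-- The category of rooted simplicial trees, with rooted metrically proper homotopy classes of rooted
continuous metrically proper maps. -/
noncomputable instance category : Category SimplicialTree.{u} where
  Hom S T := Quotient (ProperMap.setoid S T)
  id S := Quotient.mk _ (ProperMap.id S)
  comp := Quotient.map₂ ProperMap.comp fun _ _ hf _ _ hg => ProperMap.comp_homotopic hf hg
  id_comp := by
    rintro S T ⟨f⟩
    rfl
  comp_id := by
    rintro S T ⟨f⟩
    rfl
  assoc := by
    rintro S T U W ⟨f⟩ ⟨g⟩ ⟨h⟩
    rfl

/-! ## The functor `η` -/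

/-- The set `C_n` of vertices at distance `n` from the root. -/
def Level (T : SimplicialTree.{u}) (n : ℕ) : Type u := {c : T.V // T.graph.dist T.root c = n}

/-- The map `C_{n+1} → C_n` that sends a vertex to the adjacent vertex nearer to the root. -/
noncomputable def levelMap (T : SimplicialTree.{u}) (n : ℕ) (c : T.Level (n + 1)) : T.Level n :=
  ⟨T.parent c.1, by
    have h := T.depth_parent c.1
    have hc : T.depth c.1 = n + 1 := c.2
    rw [hc] at h
    exact h⟩

/-- The inverse sequence `C_1 ← C_2 ← ⋯` of a rooted tree; as the terms of inverse sequences are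
numbered from `0`, its term number `n` is `C_{n+1}`. -/
noncomputable def levels (T : SimplicialTree.{u}) : Tower (Type u) where
  sys := Functor.ofOpSequence (X := fun n => T.Level (n + 1)) fun n => ↾(T.levelMap (n + 1))

lemma levels_p_apply (T : SimplicialTree.{u}) {n m : ℕ} (h : n ≤ m) (c : T.Level (m + 1)) :
    ((T.levels.p h : T.levels.X m ⟶ T.levels.X n) c : T.Level (n + 1)).1 = T.anc (n + 1) c.1 := by
  induction m, h using Nat.le_induction with
  | base =>
    rw [Tower.p_refl]
    change c.1 = _
    have h := T.anc_self c.1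
    rw [show T.depth c.1 = n + 1 from c.2] at h
    exact h.symm
  | succ m h ih =>
    have hd : T.depth c.1 = m + 2 := c.2
    rw [← T.levels.p_comp h (Nat.le_succ m)]
    have h1 : T.levels.p (Nat.le_succ m) = ↾(T.levelMap (m + 1)) :=
      Functor.ofOpSequence_map_homOfLE_succ _ m
    rw [h1]
    change ((T.levels.p h : T.levels.X m ⟶ T.levels.X n) (T.levelMap (m + 1) c) :
      T.Level (n + 1)).1 = _
    rw [ih]
    exact T.anc_parent (by lia)

variable {S T U : SimplicialTree.{u}}

/-- The vertex in `C_{n+1}`, as a point of the realization. -/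
noncomputable def levelPoint {n : ℕ} (c : T.levels.X n) : T.Pt :=
  Pt.ofVertex (Subtype.val (p := fun c : T.V => T.graph.dist T.root c = n + 1) c)

/-- The relation between a rooted continuous metrically proper map `f` and the morphisms of inverse
sequences `(f_n, Φ)` that it induces. In the numbering `C_1 ← C_2 ← ⋯` of the levels it says that, for
all `n`, `f⁻¹(B(w, n)) ⊆ B(v, Φ n)` and, for each `c` in `C_{Φ n}`, `f_n(c)` is the vertex `c'` in
`C'_n` with `f(T_c) ⊆ T'_{c'}`. -/
def Induces (f : ProperMap S T) (F : Tower.SeqHom S.levels T.levels) : Prop :=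
  ∀ n : ℕ,
    f.toMap ⁻¹' ball (Pt.root T) ((n + 1 : ℕ) : ℝ) ⊆
        ball (Pt.root S) ((F.idx n + 1 : ℕ) : ℝ) ∧
      ∀ c : S.levels.X (F.idx n),
        f.toMap '' Pt.subtree (levelPoint c) ⊆ Pt.subtree (levelPoint (F.app n c))

lemma mem_subtree_levelPoint {n : ℕ} {c : T.levels.X n} {x : T.Pt} :
    x ∈ Pt.subtree (levelPoint c) ↔ ((n + 1 : ℕ) : ℝ) ≤ x.height ∧
      T.anc (n + 1) x.vertex =
        Subtype.val (p := fun c : T.V => T.graph.dist T.root c = n + 1) c := by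
  have hd : T.depth (Subtype.val (p := fun c : T.V => T.graph.dist T.root c = n + 1) c) = n + 1 :=
    Subtype.property (p := fun c : T.V => T.graph.dist T.root c = n + 1) c
  rw [levelPoint, Pt.mem_subtree_ofVertex, hd]

lemma levelPoint_mem_subtree_p {n m : ℕ} (h : n ≤ m) (c : S.levels.X m) :
    levelPoint c ∈ Pt.subtree (levelPoint (S.levels.p h c)) := by
  rw [mem_subtree_levelPoint]
  constructor
  · change _ ≤ ((S.graph.dist S.root _ : ℕ) : ℝ)
    rw [Subtype.property (p := fun c : S.V => S.graph.dist S.root c = m + 1) c]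
    exact_mod_cast Nat.succ_le_succ h
  · exact (S.levels_p_apply h c).symm

/-- The value of an induced morphism of sequences on the projection of `c` is the ancestor of
`f(c)`. -/
lemma Induces.val_app {f : ProperMap S T} {F : Tower.SeqHom S.levels T.levels} (hF : Induces f F)
    {n m : ℕ} (h : F.idx n ≤ m) (c : S.levels.X m) :
    Subtype.val (p := fun c : T.V => T.graph.dist T.root c = n + 1)
      ((S.levels.p h ≫ F.app n : S.levels.X m ⟶ T.levels.X n) c) =
        T.anc (n + 1) (f.toMap (levelPoint c)).vertex := by
  have := (hF n).2 _ (mem_image_of_mem f.toMap (levelPoint_mem_subtree_p h c))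
  exact (mem_subtree_levelPoint.1 this).2.symm

/-- The vertex in `C_{n+1}` on the path from the root to a point of height at least `n + 1`. -/
noncomputable def ancLevel (n : ℕ) (x : T.Pt) (h : ((n + 1 : ℕ) : ℝ) ≤ x.height) : T.levels.X n :=
  (⟨T.anc (n + 1) x.vertex, T.depth_anc (x.le_depth h)⟩ : T.Level (n + 1))

lemma exists_induces (f : ProperMap S T) :
    ∃ F : Tower.SeqHom S.levels T.levels, StrictMono F.idx ∧ Induces f F := by
  have hex : ∀ n : ℕ, ∃ k : ℕ, f.toMap ⁻¹' ball (Pt.root T) ((n + 1 : ℕ) : ℝ) ⊆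
      ball (Pt.root S) ((k + 1 : ℕ) : ℝ) := by
    intro n
    obtain ⟨N, -, h⟩ := f.exists_ball ((n + 1 : ℕ) : ℝ)
    obtain ⟨k, hk⟩ := exists_nat_ge N
    refine ⟨k, h.trans (ball_subset_ball (hk.trans ?_))⟩
    exact_mod_cast Nat.le_succ k
  choose ψ hψ using hex
  let Φ : ℕ → ℕ := fun n => ∑ i ∈ Finset.range (n + 1), (ψ i + 1)
  have hmono : StrictMono Φ := strictMono_nat_of_lt_succ fun n => by
    change _ < ∑ i ∈ Finset.range (n + 1 + 1), (ψ i + 1)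
    rw [Finset.sum_range_succ _ (n + 1)]
    change Φ n < Φ n + _
    lia
  have hle : ∀ n, ψ n ≤ Φ n := fun n => by
    change _ ≤ ∑ i ∈ Finset.range (n + 1), (ψ i + 1)
    rw [Finset.sum_range_succ]
    lia
  have hΦ : ∀ n : ℕ, f.toMap ⁻¹' ball (Pt.root T) ((n + 1 : ℕ) : ℝ) ⊆
      ball (Pt.root S) ((Φ n + 1 : ℕ) : ℝ) := fun n =>
    (hψ n).trans (ball_subset_ball (by exact_mod_cast Nat.succ_le_succ (hle n)))
  have hheight : ∀ (n : ℕ) (x : S.Pt), ((Φ n + 1 : ℕ) : ℝ) ≤ x.height →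
      ((n + 1 : ℕ) : ℝ) ≤ (f.toMap x).height := by
    intro n x hx
    by_contra hlt
    exact absurd (Pt.mem_ball_root.1 (hΦ n (Pt.mem_ball_root.2 (not_le.1 hlt)))) (not_lt.2 hx)
  have hpt : ∀ {m : ℕ} (c : S.levels.X m), (levelPoint c).height = ((m + 1 : ℕ) : ℝ) := fun c =>
    congrArg (Nat.cast (R := ℝ)) (Subtype.property (p := fun c : S.V => S.graph.dist S.root c = _) c)
  have hself : ∀ {m : ℕ} (c : S.levels.X m), levelPoint c ∈ Pt.subtree (levelPoint c) := by
    intro m c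
    have h := levelPoint_mem_subtree_p (le_refl m) c
    rwa [Tower.p_refl] at h
  let φ : ∀ n, S.levels.X (Φ n) ⟶ T.levels.X n := fun n =>
    ↾fun c => ancLevel n (f.toMap (levelPoint c)) (hheight n _ (hpt c).ge)
  have hφ : ∀ (n : ℕ) (c : S.levels.X (Φ n)),
      f.toMap '' Pt.subtree (levelPoint c) ⊆ Pt.subtree (levelPoint (φ n c)) := by
    rintro n c _ ⟨x, hx, rfl⟩
    have hs : IsPreconnected (f.toMap '' Pt.subtree (levelPoint c)) :=
      (Pt.isPreconnected_subtree _).image _ f.toMap.continuous.continuousOn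
    have hn : ∀ y ∈ f.toMap '' Pt.subtree (levelPoint c), ((n + 1 : ℕ) : ℝ) ≤ y.height := by
      rintro _ ⟨y, hy, rfl⟩
      exact hheight n y (mem_subtree_levelPoint.1 hy).1
    rw [mem_subtree_levelPoint]
    exact ⟨hn _ (mem_image_of_mem _ hx), Pt.anc_eq_of_isPreconnected hs hn
      (mem_image_of_mem _ hx) (mem_image_of_mem _ (hself c))⟩
  have hval : ∀ {n m : ℕ} (h : Φ n ≤ m) (c : S.levels.X m),
      Subtype.val (p := fun c : T.V => T.graph.dist T.root c = n + 1)
        ((S.levels.p h ≫ φ n : S.levels.X m ⟶ T.levels.X n) c) =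
          T.anc (n + 1) (f.toMap (levelPoint c)).vertex := by
    intro n m h c
    have := hφ n _ (mem_image_of_mem f.toMap (levelPoint_mem_subtree_p h c))
    exact (mem_subtree_levelPoint.1 this).2.symm
  refine ⟨⟨Φ, φ, fun {n n'} h => ⟨Φ n', hmono.monotone h, le_rfl, ?_⟩⟩, hmono,
    fun n => ⟨hΦ n, hφ n⟩⟩
  ext c
  refine Subtype.ext (Eq.trans (hval _ c) ?_)
  have h1 := T.levels_p_apply h
    ((S.levels.p (le_refl (Φ n')) ≫ φ n' : S.levels.X (Φ n') ⟶ T.levels.X n') c)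
  have h2 := hval (le_refl (Φ n')) c
  refine Eq.trans ?_ h1.symm
  refine Eq.trans ?_ (congrArg (T.anc (n + 1)) h2).symm
  exact (T.anc_anc _ (Nat.succ_le_succ h) (Pt.le_depth _ (hheight n' _ (hpt c).ge))).symm

/-- Homotopic maps induce equivalent morphisms of sequences. -/
lemma Induces.equivalent {f g : ProperMap S T} (h : ProperMap.Homotopic f g)
    {F G : Tower.SeqHom S.levels T.levels} (hF : Induces f F) (hG : Induces g G) :
    F.Equivalent G := by
  intro n
  obtain ⟨H, -, h1⟩ := h
  obtain ⟨N, -, hN⟩ := h1 ((n + 1 : ℕ) : ℝ) (by positivity)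
  obtain ⟨k, hk⟩ := exists_nat_ge N
  have ha : F.idx n ≤ F.idx n + G.idx n + k := by lia
  have hb : G.idx n ≤ F.idx n + G.idx n + k := by lia
  refine ⟨F.idx n + G.idx n + k, ha, hb, ?_⟩
  ext c
  refine Subtype.ext ((hF.val_app ha c).trans (Eq.trans ?_ (hG.val_app hb c).symm))
  have hc : (levelPoint c).height = ((F.idx n + G.idx n + k + 1 : ℕ) : ℝ) :=
    congrArg (Nat.cast (R := ℝ)) (Subtype.property (p := fun c : S.V => S.graph.dist S.root c = _) c)
  have hcont : Continuous fun t => H (t, levelPoint c) := by fun_prop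
  refine Pt.anc_eq_of_isPreconnected (isPreconnected_range hcont) ?_
    ⟨0, H.map_zero_left _⟩ ⟨1, H.map_one_left _⟩
  rintro _ ⟨t, rfl⟩
  by_contra hlt
  have h2 := Pt.mem_ball_root.1 (hN t _ (Pt.mem_ball_root.2 (not_le.1 hlt)))
  rw [hc] at h2
  push_cast at h2
  have h3 : (0 : ℝ) ≤ F.idx n := Nat.cast_nonneg _
  have h4 : (0 : ℝ) ≤ G.idx n := Nat.cast_nonneg _
  linarith

lemma induces_id (T : SimplicialTree.{u}) : Induces (ProperMap.id T) (Tower.SeqHom.id T.levels) := by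
  refine fun n => ⟨subset_rfl, fun c => ?_⟩
  rintro _ ⟨x, hx, rfl⟩
  exact hx

lemma Induces.comp {f : ProperMap S T} {g : ProperMap T U} {F : Tower.SeqHom S.levels T.levels}
    {G : Tower.SeqHom T.levels U.levels} (hF : Induces f F) (hG : Induces g G) :
    Induces (f.comp g) (F.comp G) := by
  refine fun n => ⟨fun x hx => (hF _).1 ((hG n).1 hx), fun c => ?_⟩
  rintro _ ⟨x, hx, rfl⟩
  exact (hG n).2 _ (mem_image_of_mem _ ((hF _).2 c (mem_image_of_mem _ hx)))

/-- A morphism of sequences induced by a map (for a strictly increasing choice of the indices). -/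
noncomputable def inducedHom (f : ProperMap S T) : Tower.SeqHom S.levels T.levels :=
  (exists_induces f).choose

lemma induces_inducedHom (f : ProperMap S T) : Induces f (inducedHom f) :=
  (exists_induces f).choose_spec.2

/-- The functor `η` from rooted simplicial trees to `Tower-Set`: it sends a rooted tree to the inverse
sequence of its level sets, and the class of a map to the class of the morphisms of sequences that the
map induces. -/
noncomputable def eta : SimplicialTree.{u} ⥤ Tower (Type u) where
  obj T := T.levels
  map {S T} := Quotient.map inducedHom fun f g h =>
    Induces.equivalent h (induces_inducedHom f) (induces_inducedHom g)
  map_id T := Quotient.sound (Induces.equivalent (ProperMap.homotopic_equivalence.refl _)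
    (induces_inducedHom _) (induces_id T))
  map_comp := by
    rintro S T U ⟨f⟩ ⟨g⟩
    exact Quotient.sound (Induces.equivalent (ProperMap.homotopic_equivalence.refl _)
      (induces_inducedHom _) ((induces_inducedHom f).comp (induces_inducedHom g)))

/-- The value of `η` on the class of `f` is the class of every morphism of sequences induced by `f`,
whatever the choice of the indices. -/
lemma eta_map_mk (f : ProperMap S T) {F : Tower.SeqHom S.levels T.levels} (hF : Induces f F) :
    eta.map (Quotient.mk (ProperMap.setoid S T) f : S ⟶ T) =
      Quotient.mk (Tower.SeqHom.setoid S.levels T.levels) F :=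
  Quotient.sound (Induces.equivalent (ProperMap.homotopic_equivalence.refl _)
    (induces_inducedHom f) hF)

end SimplicialTree

/-! The functor is shown to be faithful, full and essentially surjective. Throughout, a point is
controlled by its height and by the path from the root to it, and two points by the length `common`
of the shared part of their paths, which is their Gromov product at the root.

Faithfulness. If `f` and `g` induce equivalent morphisms, then for each `n` all points `x` far
enough out have images below the same vertex at depth `n + 1`, so the common part of `f x` and `g x`
becomes arbitrarily long. Sliding `f x` towards the root until only this common part is left is a
metrically proper homotopy, and sliding `g x` ends at the same map (`homotopic_of_common`,
`homotopic_of_equivalent`).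

Fullness. A morphism of sequences gives maps `vertexMap F k` into the vertices at depth `k`. Each is
meaningful only from some depth on, and compatible with the lower ones only from some depth `Ψ k`
on. Choose a `1`-Lipschitz function `ρ` tending to infinity so slowly that height `t` is already
beyond every threshold needed at depth `⌈ρ t⌉` (`exists_slow_function`). Send a point of height `t`
to the point of height `ρ t` on the path to the prescribed vertex. The common part of two images is
at least `ρ` of the common part of the points, so the map is `1`-Lipschitz; it is proper since `ρ`
tends to infinity (`exists_properMap`).

Essential surjectivity. The disjoint union of the terms of a sequence, with a root added and each
element joined to its image under the bonding map, is a tree whose levels are the given terms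
(`isTree_ofParent`, `nonempty_levels_tree_iso`). -/

namespace SimplicialTree

variable {S T : SimplicialTree.{u}}

/-! ### Truncating the path from the root to a point -/

lemma min_le_meet_anc {a b : T.V} {k l : ℕ} (hk : k ≤ T.depth a) (hl : l ≤ T.depth b) :
    min (min k l) (T.meet a b) ≤ T.meet (T.anc k a) (T.anc l b) := by
  have h1 : min (min k l) (T.meet a b) ≤ k := (min_le_left _ _).trans (min_le_left _ _)
  have h2 : min (min k l) (T.meet a b) ≤ l := (min_le_left _ _).trans (min_le_right _ _)
  have h3 : min (min k l) (T.meet a b) ≤ T.meet a b := min_le_right _ _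
  rw [T.le_meet_iff (by rwa [T.depth_anc hk]) (by rwa [T.depth_anc hl]), T.anc_anc a h1 hk,
    T.anc_anc b h2 hl, ← T.le_meet_iff (h1.trans hk) (h2.trans hl)]
  exact h3

namespace Pt

lemma common_nonneg (x y : T.Pt) : 0 ≤ common x y := by
  rw [common, gromov_eq_meet]
  exact le_min (le_min x.height_nonneg y.height_nonneg) (Nat.cast_nonneg _)

lemma continuous_height : Continuous (height : T.Pt → ℝ) := by
  have : (height : T.Pt → ℝ) = fun x => dist (root T) x := funext fun x => (dist_root x).symm
  rw [this]
  fun_prop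

/-- The common part is a Gromov product, hence a combination of heights and the distance. -/
lemma continuous_common : Continuous fun x : T.Pt × T.Pt => common x.1 x.2 := by
  have : (fun x : T.Pt × T.Pt => common x.1 x.2) =
      fun x => (x.1.height + x.2.height - dist x.1 x.2) / 2 := by
    funext x
    rw [dist_def]
    ring
  rw [this]
  have := continuous_height (T := T)
  fun_prop

/-- The point at height `s` on the path from the root to `x` (the nearest end of the path if there is
no such point). -/
noncomputable def trim (x : T.Pt) (s : ℝ) : T.Pt :=
  onPath x.vertex (max 0 (min s x.height)) (le_max_left _ _)
    ((max_le x.height_nonneg (min_le_right _ _)).trans x.height_le)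

lemma height_trim (x : T.Pt) (s : ℝ) : (trim x s).height = max 0 (min s x.height) := rfl

lemma trim_of_height_le {x : T.Pt} {s : ℝ} (h : x.height ≤ s) : trim x s = x := by
  have h1 : max 0 (min s x.height) = x.height := by
    rw [min_eq_right h, max_eq_right x.height_nonneg]
  rw [trim]
  simp only [h1]
  exact onPath_vertex x

/-- Shortening two paths can only destroy the part of their common piece that lies above one of the
new ends. -/
lemma le_common_trim (x y : T.Pt) (s t : ℝ) :
    min (min (trim x s).height (trim y t).height) (common x y) ≤ common (trim x s) (trim y t) := by
  rw [common.eq_def (trim x s), gromov_eq_meet]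
  refine le_min (min_le_left _ _) ?_
  have h1 : (trim x s).height ≤ (⌈(trim x s).height⌉₊ : ℝ) := Nat.le_ceil _
  have h2 : (trim y t).height ≤ (⌈(trim y t).height⌉₊ : ℝ) := Nat.le_ceil _
  have h3 : common x y ≤ T.meet x.vertex y.vertex := by
    rw [common, gromov_eq_meet]
    exact min_le_right _ _
  refine (min_le_min (min_le_min h1 h2) h3).trans ?_
  have hx : (trim x s).height ≤ T.depth x.vertex :=
    (max_le x.height_nonneg (min_le_right _ _)).trans x.height_le
  have hy : (trim y t).height ≤ T.depth y.vertex :=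
    (max_le y.height_nonneg (min_le_right _ _)).trans y.height_le
  exact_mod_cast min_le_meet_anc (Nat.ceil_le.2 hx) (Nat.ceil_le.2 hy)

lemma abs_height_sub_le (x y : T.Pt) : |x.height - y.height| ≤ dist x y := by
  have h1 := common_le_left x y
  have h2 := common_le_right x y
  rw [dist_def, abs_le]
  constructor <;> linarith

/-- This joint Lipschitz-type bound makes `trim` continuous in the point and the height together, as
the sliding homotopies require. -/
lemma dist_trim_le (x y : T.Pt) (s t : ℝ) : dist (trim x s) (trim y t) ≤ dist x y + |s - t| := by
  have h := le_common_trim x y s t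
  have hxy := abs_height_sub_le x y
  have hst := abs_nonneg (s - t)
  rw [dist_def (trim x s)]
  rcases min_le_iff.1 h with h | h
  -- One truncated path contains the other here, so the distance is the difference of the heights.
  · have h4 : |(trim x s).height - (trim y t).height| ≤ dist x y + |s - t| := by
      rw [height_trim, height_trim, max_comm 0, max_comm 0]
      refine (abs_max_sub_max_le_abs _ _ _).trans ((abs_min_sub_min_le_max _ _ _ _).trans ?_)
      exact max_le (by linarith [dist_nonneg (x := x) (y := y)]) (by linarith)
    rw [abs_le] at h4
    rcases min_le_iff.1 h with h | h <;> linarith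
  -- Here the whole common part survives, and truncation only lowers the two heights.
  · have hx : (trim x s).height ≤ x.height := max_le x.height_nonneg (min_le_right _ _)
    have hy : (trim y t).height ≤ y.height := max_le y.height_nonneg (min_le_right _ _)
    rw [dist_def x y]
    linarith

lemma continuous_trim : Continuous fun x : T.Pt × ℝ => trim x.1 x.2 := by
  rw [continuous_iff_continuousAt]
  intro x
  refine tendsto_iff_dist_tendsto_zero.2 (squeeze_zero (fun _ => dist_nonneg)
    (fun y => dist_trim_le y.1 x.1 y.2 x.2) ?_)
  have : Continuous fun y : T.Pt × ℝ => dist y.1 x.1 + |y.2 - x.2| := by fun_prop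
  simpa using this.tendsto x

/-- Up to the height of the common part the two paths coincide. Rounding that height up does no
harm, because the depth of the last common ancestor is an integer. -/
lemma trim_common (x y : T.Pt) : trim x (common x y) = trim y (common x y) := by
  have h1 : max 0 (min (common x y) x.height) = common x y := by
    rw [min_eq_left (common_le_left x y), max_eq_right (common_nonneg x y)]
  have h2 : max 0 (min (common x y) y.height) = common x y := by
    rw [min_eq_left (common_le_right x y), max_eq_right (common_nonneg x y)]
  have h3 : ⌈common x y⌉₊ ≤ T.meet x.vertex y.vertex := by
    rw [Nat.ceil_le, common, gromov_eq_meet]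
    exact min_le_right _ _
  refine Pt.ext ?_ (h1.trans h2.symm)
  change T.anc ⌈max 0 (min (common x y) x.height)⌉₊ x.vertex =
    T.anc ⌈max 0 (min (common x y) y.height)⌉₊ y.vertex
  rw [h1, h2, ← T.le_meet_iff (h3.trans (T.meet_le_left _ _)) (h3.trans (T.meet_le_right _ _))]
  exact h3

lemma height_root : (root T).height = 0 := by
  simp [root, ofVertex]

lemma eq_root_of_height {x : T.Pt} (h : x.height = 0) : x = root T := by
  rw [← dist_eq_zero, dist_comm, dist_root, h]

end Pt

/-! ### Sliding homotopies and faithfulness -/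

namespace ProperMap

/-- A metrically proper map, from a continuous rooted map that leaves every ball. -/
noncomputable def ofHeight (f : C(S.Pt, T.Pt)) (h0 : f (Pt.root S) = Pt.root T)
    (h : ∀ M : ℝ, ∃ N : ℝ, ∀ x, (f x).height < M → x.height < N) : ProperMap S T where
  toMap := f
  map_root := h0
  proper A hA := by
    obtain ⟨M, hM⟩ := hA.subset_ball (Pt.root T)
    obtain ⟨N, hN⟩ := h M
    refine (isBounded_ball (x := Pt.root S) (r := N)).subset fun x hx => ?_
    exact Pt.mem_ball_root.2 (hN x (Pt.mem_ball_root.1 (hM hx)))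

lemma exists_height (f : ProperMap S T) (M : ℝ) :
    ∃ N : ℝ, ∀ x, (f.toMap x).height < M → x.height < N := by
  obtain ⟨N, -, h⟩ := f.exists_ball M
  exact ⟨N, fun x hx => Pt.mem_ball_root.1 (h (Pt.mem_ball_root.2 hx))⟩

/-- The map that sends `x` to the point at height `φ x` on the path from the root to `f x`. -/
noncomputable def trim (f : ProperMap S T) (φ : C(S.Pt, ℝ))
    (hφ : ∀ M : ℝ, ∃ N : ℝ, ∀ x, φ x < M → x.height < N) : ProperMap S T :=
  ofHeight ⟨fun x => Pt.trim (f.toMap x) (φ x),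
      Pt.continuous_trim.comp (f.toMap.continuous.prodMk φ.continuous)⟩
    (by
      refine Pt.eq_root_of_height ?_
      change max 0 (min _ (f.toMap (Pt.root S)).height) = 0
      rw [f.map_root, Pt.height_root]
      exact max_eq_left (min_le_right _ _))
    (fun M => by
      obtain ⟨N, hN⟩ := f.exists_height M
      obtain ⟨N', hN'⟩ := hφ M
      refine ⟨max N N', fun x hx => ?_⟩
      have hx : max 0 (min (φ x) (f.toMap x).height) < M := hx
      rcases min_lt_iff.1 ((le_max_right _ _).trans_lt hx) with h | h
      · exact (hN' x h).trans_le (le_max_right _ _)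
      · exact (hN x h).trans_le (le_max_left _ _))

/-- At time `t` the value is cut at the height `(1 - t) * (f x).height + t * φ x`: no cut at time
`0`, the prescribed one at time `1`. -/
lemma homotopic_trim (f : ProperMap S T) (φ : C(S.Pt, ℝ))
    (hφ : ∀ M : ℝ, ∃ N : ℝ, ∀ x, φ x < M → x.height < N) : Homotopic f (f.trim φ hφ) := by
  have hcont : Continuous fun y : unitInterval × S.Pt =>
      Pt.trim (f.toMap y.2) ((1 - (y.1 : ℝ)) * (f.toMap y.2).height + y.1 * φ y.2) := by
    have h := Pt.continuous_height (T := T)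
    have h' := f.toMap.continuous
    have h'' : Continuous fun y : unitInterval × S.Pt =>
        (f.toMap y.2, (1 - (y.1 : ℝ)) * (f.toMap y.2).height + y.1 * φ y.2) := by fun_prop
    exact Pt.continuous_trim.comp h''
  refine ⟨⟨⟨_, hcont⟩, fun x => ?_, fun x => ?_⟩, fun t => ?_, fun M _ => ?_⟩
  · exact Pt.trim_of_height_le (by simp)
  · change Pt.trim _ _ = Pt.trim _ _
    simp
  · refine Pt.eq_root_of_height ?_
    change max 0 (min _ (f.toMap (Pt.root S)).height) = 0
    rw [f.map_root, Pt.height_root]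
    exact max_eq_left (min_le_right _ _)
  · obtain ⟨N, hN⟩ := f.exists_height M
    obtain ⟨N', hN'⟩ := hφ M
    refine ⟨max (max N N') 1, lt_max_of_lt_right one_pos, fun t x hx => ?_⟩
    have hx := Pt.mem_ball_root.1 hx
    change max 0 (min ((1 - (t : ℝ)) * (f.toMap x).height + t * φ x) (f.toMap x).height) < M at hx
    rw [Pt.mem_ball_root]
    refine lt_of_lt_of_le ?_ (le_max_left _ _)
    rw [lt_max_iff]
    -- Far out, both the height of `f x` and `φ x` are at least `M`, hence so is each convex
    -- combination of them.
    by_contra! hcon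
    have h1 : M ≤ (f.toMap x).height := not_lt.1 fun h => (hN x h).not_ge hcon.1
    have h2 : M ≤ φ x := not_lt.1 fun h => (hN' x h).not_ge hcon.2
    refine ((le_max_right _ _).trans_lt hx).not_ge (le_min ?_ h1)
    have h3 := mul_le_mul_of_nonneg_left h1 (sub_nonneg.2 t.2.2)
    have h4 := mul_le_mul_of_nonneg_left h2 t.2.1
    linarith

/-- Two maps are homotopic if the common part of the paths to their values gets long far from the
root. -/
lemma homotopic_of_common {f g : ProperMap S T}
    (h : ∀ M : ℝ, ∃ N : ℝ, ∀ x, Pt.common (f.toMap x) (g.toMap x) < M → x.height < N) :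
    Homotopic f g := by
  let φ : C(S.Pt, ℝ) := ⟨fun x => Pt.common (f.toMap x) (g.toMap x),
    Pt.continuous_common.comp (f.toMap.continuous.prodMk g.toMap.continuous)⟩
  -- Both maps slide down to the end of the common part, where they agree.
  have e : f.trim φ h = g.trim φ h := by
    have : (f.trim φ h).toMap = (g.trim φ h).toMap :=
      ContinuousMap.ext fun x => Pt.trim_common (f.toMap x) (g.toMap x)
    unfold trim ofHeight at this ⊢
    congr
  have hf := f.homotopic_trim φ h
  rw [e] at hf
  exact homotopic_equivalence.trans hf (homotopic_equivalence.symm (g.homotopic_trim φ h))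

end ProperMap

/-- Beyond height `m + 1`, the images of a point under both maps lie below one vertex at depth `n +
1`, since the components of `F` and `G` agree after restriction to the term `m`. Thus the common
part of the images has length at least `n + 1`. -/
lemma homotopic_of_equivalent {f g : ProperMap S T} {F G : Tower.SeqHom S.levels T.levels}
    (hF : Induces f F) (hG : Induces g G) (h : F.Equivalent G) : ProperMap.Homotopic f g := by
  refine ProperMap.homotopic_of_common fun M => ?_
  obtain ⟨n, hn⟩ := exists_nat_ge M
  obtain ⟨m, ha, hb, e⟩ := h n
  refine ⟨((m + 1 : ℕ) : ℝ), fun x hx => ?_⟩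
  by_contra hlt
  rw [not_lt] at hlt
  -- A point lies in the subtree of each projection of its ancestor at depth `m + 1`; this brings
  -- the inclusions in `Induces` to bear on `x`.
  have key : ∀ {k : ℕ} (hk : k ≤ m),
      x ∈ Pt.subtree (levelPoint (S.levels.p hk (ancLevel m x hlt))) := by
    intro k hk
    rw [mem_subtree_levelPoint]
    refine ⟨le_trans (by exact_mod_cast Nat.succ_le_succ hk) hlt, ?_⟩
    refine Eq.trans ?_ (S.levels_p_apply hk (ancLevel m x hlt)).symm
    exact (S.anc_anc _ (Nat.succ_le_succ hk) (x.le_depth hlt)).symm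
  have hf := mem_subtree_levelPoint.1 ((hF n).2 _ (mem_image_of_mem f.toMap (key ha)))
  have hg := mem_subtree_levelPoint.1 ((hG n).2 _ (mem_image_of_mem g.toMap (key hb)))
  have e' : F.app n (S.levels.p ha (ancLevel m x hlt)) =
      G.app n (S.levels.p hb (ancLevel m x hlt)) :=
    ConcreteCategory.congr_hom e (ancLevel m x hlt)
  rw [e'] at hf
  have h1 : n + 1 ≤ T.meet (f.toMap x).vertex (g.toMap x).vertex :=
    (T.le_meet_iff (Pt.le_depth _ hf.1) (Pt.le_depth _ hg.1)).2 (hf.2.trans hg.2.symm)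
  have h2 : ((n + 1 : ℕ) : ℝ) ≤ Pt.common (f.toMap x) (g.toMap x) := by
    rw [Pt.common, gromov_eq_meet]
    exact le_min (le_min hf.1 hg.1) (Nat.cast_le.2 h1)
  push_cast at h2
  linarith

instance faithful_eta : (eta.{u}).Faithful where
  map_injective {S T} := by
    rintro ⟨f⟩ ⟨g⟩ h
    exact Quotient.sound (homotopic_of_equivalent (induces_inducedHom f) (induces_inducedHom g)
      (Quotient.exact h))

/-! ### Slow functions and the construction of proper maps -/

/-- For a sequence `Ψ` of natural numbers there is a `1`-Lipschitz function that tends to infinity so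
slowly that it takes values above `k` only from `Ψ (k + 1)` on. -/
lemma exists_slow_function (Ψ : ℕ → ℕ) :
    ∃ ρ : ℝ → ℝ, (∀ s t, s ≤ t → ρ s ≤ ρ t ∧ ρ t ≤ ρ s + (t - s)) ∧ (∀ t, 0 ≤ ρ t) ∧ ρ 0 = 0 ∧
      (∀ M : ℝ, ∃ N : ℝ, ∀ t, ρ t < M → t < N) ∧
      ∀ (k : ℕ) (t : ℝ), k < ρ t → Ψ (k + 1) ≤ t := by
  -- The function is the infimum over `k` of ramps that stay at `k` until `Ψ (k + 1)` and then rise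
  -- with slope `1`. Each ramp is nondecreasing and `1`-Lipschitz, so the infimum is too, and `Ψ`
  -- need not be monotone.
  let a : ℝ → ℕ → ℝ := fun t k => k + max 0 (t - Ψ (k + 1))
  have ha : ∀ t k, 0 ≤ a t k := fun t k => add_nonneg (Nat.cast_nonneg _) (le_max_left _ _)
  have hb : ∀ t, BddBelow (range (a t)) := fun t => ⟨0, by rintro _ ⟨k, rfl⟩; exact ha t k⟩
  refine ⟨fun t => ⨅ k, a t k, fun s t h => ⟨?_, ?_⟩, fun t => le_ciInf (ha t), ?_, fun M => ?_,
    fun k t h => ?_⟩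
  · refine ciInf_mono (hb s) fun k => ?_
    exact add_le_add le_rfl (max_le_max le_rfl (by linarith))
  · rw [← sub_le_iff_le_add]
    refine le_ciInf fun k => ?_
    have h1 := ciInf_le (hb t) k
    have h2 : a t k ≤ a s k + (t - s) := by
      change _ + max _ _ ≤ _ + max _ _ + _
      have h3 := le_max_left 0 (s - (Ψ (k + 1) : ℝ))
      have h4 := le_max_right 0 (s - (Ψ (k + 1) : ℝ))
      have : max 0 (t - (Ψ (k + 1) : ℝ)) ≤ max 0 (s - (Ψ (k + 1) : ℝ)) + (t - s) :=
        max_le (by linarith) (by linarith)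
      linarith
    linarith
  · refine le_antisymm ((ciInf_le (hb 0) 0).trans_eq ?_) (le_ciInf (ha 0))
    change ((0 : ℕ) : ℝ) + max 0 _ = 0
    rw [max_eq_left (by simp)]
    simp
  · obtain ⟨n, hn⟩ := exists_nat_ge M
    -- Only the ramps with `k < n` can have a value below `M`; the sum bounds all their starting
    -- points at once.
    refine ⟨n + ∑ i ∈ Finset.range n, (Ψ (i + 1) : ℝ), fun t ht => ?_⟩
    obtain ⟨k, hk⟩ := exists_lt_of_ciInf_lt ht
    change (k : ℝ) + max _ _ < M at hk
    have h1 := le_max_left 0 (t - (Ψ (k + 1) : ℝ))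
    have h2 := le_max_right 0 (t - (Ψ (k + 1) : ℝ))
    have hkn : k < n := by
      have : (k : ℝ) < n := by linarith
      exact_mod_cast this
    have h3 : (Ψ (k + 1) : ℝ) ≤ ∑ i ∈ Finset.range n, (Ψ (i + 1) : ℝ) :=
      Finset.single_le_sum (f := fun i => (Ψ (i + 1) : ℝ)) (fun _ _ => Nat.cast_nonneg _)
        (Finset.mem_range.2 hkn)
    have h4 : (0 : ℝ) ≤ k := Nat.cast_nonneg k
    linarith
  · by_contra hlt
    have h1 := h.trans_le (ciInf_le (hb t) k)
    change (k : ℝ) < k + max _ _ at h1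
    rw [max_eq_left (by linarith)] at h1
    linarith

/-- A compatible family of maps of vertices `G k`, each defined from depth `Ψ k` on and with values at
depth `k`, gives a metrically proper map whose values have the vertices `G k c` as their ancestors. -/
lemma exists_properMap (Ψ : ℕ → ℕ) (G : ℕ → S.V → T.V)
    (hdepth : ∀ k c, Ψ k ≤ S.depth c → T.depth (G k c) = k)
    (hanc : ∀ j k c, j ≤ k → Ψ k ≤ S.depth c → T.anc j (G k c) = G j c)
    (hG : ∀ j m c, Ψ j ≤ m → m ≤ S.depth c → G j (S.anc m c) = G j c) (h0 : Ψ 0 = 0) :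
    ∃ f : ProperMap S T, ∀ n : ℕ, ∃ N : ℝ, ∀ x : S.Pt, N ≤ x.height →
      T.anc n (f.toMap x).vertex = G n x.vertex := by
  obtain ⟨ρ, hρ, hρ0, hρz, hρi, hρΨ⟩ := exists_slow_function Ψ
  have hceil : ∀ t : ℝ, 0 ≤ t → (Ψ ⌈ρ t⌉₊ : ℝ) ≤ t := by
    intro t ht
    -- For a positive ceiling `k + 1` one has `k < ρ t`, which is what the slowness of `ρ` speaks
    -- of; the ceiling `0` needs `Ψ 0 = 0`.
    rcases Nat.eq_zero_or_eq_succ_pred ⌈ρ t⌉₊ with h | h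
    · rw [h, h0]
      simpa using ht
    · rw [h]
      exact hρΨ _ t (Nat.lt_ceil.1 (by lia))
  have hx : ∀ x : S.Pt, Ψ ⌈ρ x.height⌉₊ ≤ S.depth x.vertex := fun x =>
    x.le_depth (hceil _ x.height_nonneg)
  let f : S.Pt → T.Pt := fun x => ⟨G ⌈ρ x.height⌉₊ x.vertex, ρ x.height, hρ0 _, hdepth _ _ (hx x)⟩
  -- This estimate carries the continuity: with the Lipschitz bound for `ρ` from the common part up
  -- to each point, it makes `f` `1`-Lipschitz.
  have hcommon : ∀ x y, ρ (Pt.common x y) ≤ Pt.common (f x) (f y) := by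
    intro x y
    have h1 := (hρ _ _ (Pt.common_le_left x y)).1
    have h2 := (hρ _ _ (Pt.common_le_right x y)).1
    rw [Pt.common.eq_def (f x), gromov_eq_meet]
    refine le_min (le_min h1 h2) ((Nat.le_ceil _).trans (Nat.cast_le.2 ?_))
    set r := Pt.common x y with hr
    -- The last common ancestor of the two vertices is deep enough to determine the value of `G` at
    -- depth `⌈ρ r⌉₊`, so both images have the same ancestor there.
    have h3 : Ψ ⌈ρ r⌉₊ ≤ S.meet x.vertex y.vertex := by
      have : (Ψ ⌈ρ r⌉₊ : ℝ) ≤ S.meet x.vertex y.vertex := by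
        refine (hceil r (Pt.common_nonneg x y)).trans ?_
        rw [hr, Pt.common, gromov_eq_meet]
        exact min_le_right _ _
      exact_mod_cast this
    have h4 := Nat.ceil_le_ceil h1
    have h5 := Nat.ceil_le_ceil h2
    have h6 := S.meet_le_left x.vertex y.vertex
    have h7 := S.meet_le_right x.vertex y.vertex
    refine (T.le_meet_iff ?_ ?_).2 ?_
    · exact h4.trans_eq (hdepth _ _ (hx x)).symm
    · exact h5.trans_eq (hdepth _ _ (hx y)).symm
    · change T.anc _ (G _ _) = T.anc _ (G _ _)
      rw [hanc _ _ _ h4 (hx x), hanc _ _ _ h5 (hx y), ← hG _ _ x.vertex h3 h6,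
        ← hG _ _ y.vertex h3 h7, (S.le_meet_iff h6 h7).1 le_rfl]
  have hcont : Continuous f := by
    refine (LipschitzWith.of_dist_le_mul (K := 1) fun x y => ?_).continuous
    have h1 := (hρ _ _ (Pt.common_le_left x y)).2
    have h2 := (hρ _ _ (Pt.common_le_right x y)).2
    have h3 := hcommon x y
    rw [Pt.dist_def, Pt.dist_def]
    change ρ x.height + ρ y.height - _ ≤ _
    rw [NNReal.coe_one, one_mul]
    linarith
  refine ⟨ProperMap.ofHeight ⟨f, hcont⟩ (Pt.eq_root_of_height ?_) fun M => ?_, fun n => ?_⟩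
  · change ρ (Pt.root S).height = 0
    rw [Pt.height_root, hρz]
  · obtain ⟨N, hN⟩ := hρi M
    exact ⟨N, fun x h => hN _ h⟩
  · obtain ⟨N, hN⟩ := hρi n
    refine ⟨N, fun x h => ?_⟩
    refine hanc _ _ _ ?_ (hx x)
    have h1 : (n : ℝ) ≤ ρ x.height := not_lt.1 fun h' => (hN _ h').not_ge h
    exact Nat.cast_le.1 (h1.trans (Nat.le_ceil _))

/-! ### Fullness -/

open Classical in
/-- The map of vertices induced by a morphism of sequences, with values in `C_k`; it is the constant
map to the root where the morphism of sequences is not defined. -/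
noncomputable def vertexMap (F : Tower.SeqHom S.levels T.levels) : ℕ → S.V → T.V
  | 0, _ => T.root
  | n + 1, c =>
    if h : F.idx n + 1 ≤ S.depth c then
      Subtype.val (p := fun c : T.V => T.graph.dist T.root c = n + 1)
        (F.app n (⟨S.anc (F.idx n + 1) c, S.depth_anc h⟩ : S.Level (F.idx n + 1)))
    else T.root

lemma vertexMap_succ (F : Tower.SeqHom S.levels T.levels) {n m : ℕ} (h : F.idx n ≤ m)
    (c : S.levels.X m) :
    vertexMap F (n + 1) (Subtype.val (p := fun c : S.V => S.graph.dist S.root c = m + 1) c) =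
      Subtype.val (p := fun c : T.V => T.graph.dist T.root c = n + 1)
        ((S.levels.p h ≫ F.app n : S.levels.X m ⟶ T.levels.X n) c) := by
  have hc : S.depth (Subtype.val (p := fun c : S.V => S.graph.dist S.root c = m + 1) c) = m + 1 :=
    Subtype.property (p := fun c : S.V => S.graph.dist S.root c = m + 1) c
  have h' := S.levels_p_apply h c
  rw [vertexMap, dif_pos (by rw [hc]; exact Nat.succ_le_succ h)]
  refine congrArg (fun d => Subtype.val (p := fun c : T.V => T.graph.dist T.root c = n + 1)
    (F.app n d)) ?_
  exact Subtype.ext h'.symm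

lemma vertexMap_anc (F : Tower.SeqHom S.levels T.levels) {n m : ℕ} {c : S.V}
    (h : F.idx n + 1 ≤ m) (hm : m ≤ S.depth c) :
    vertexMap F (n + 1) (S.anc m c) = vertexMap F (n + 1) c := by
  rw [vertexMap, vertexMap, dif_pos (by rwa [S.depth_anc hm]), dif_pos (h.trans hm)]
  simp only [S.anc_anc c h hm]

lemma depth_vertexMap (F : Tower.SeqHom S.levels T.levels) {n : ℕ} {c : S.V}
    (h : F.idx n + 1 ≤ S.depth c) : T.depth (vertexMap F (n + 1) c) = n + 1 := by
  rw [vertexMap, dif_pos h]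
  exact Subtype.property (p := fun c : T.V => T.graph.dist T.root c = n + 1) _

/-- Bonding maps are passages to ancestors, so this is the compatibility condition of `F`, read on
vertices. -/
lemma exists_anc_vertexMap (F : Tower.SeqHom S.levels T.levels) {n n' : ℕ} (hn : n ≤ n') :
    ∃ m, ∀ c : S.V, m + 1 ≤ S.depth c →
      T.anc (n + 1) (vertexMap F (n' + 1) c) = vertexMap F (n + 1) c := by
  obtain ⟨m, h1, h2, e⟩ := F.compat hn
  refine ⟨m, fun c hc => ?_⟩
  rw [← vertexMap_anc F (Nat.succ_le_succ h1) hc, ← vertexMap_anc F (Nat.succ_le_succ h2) hc]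
  let d : S.levels.X m := (⟨S.anc (m + 1) c, S.depth_anc hc⟩ : S.Level (m + 1))
  have k1 := vertexMap_succ F h1 d
  have k2 := vertexMap_succ F h2 d
  refine Eq.trans ?_ k1.symm
  rw [e]
  refine (congrArg (T.anc (n + 1)) k2).trans ?_
  exact (T.levels_p_apply hn ((S.levels.p h2 ≫ F.app n' : S.levels.X m ⟶ T.levels.X n') d)).symm

/-- Every morphism of inverse sequences of levels is equivalent to an induced one. -/
lemma exists_inducedHom_equivalent (F : Tower.SeqHom S.levels T.levels) :
    ∃ f : ProperMap S T, (inducedHom f).Equivalent F := by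
  have hcompat : ∀ n n' : ℕ, ∃ m : ℕ, n ≤ n' → ∀ c : S.V, m + 1 ≤ S.depth c →
      T.anc (n + 1) (vertexMap F (n' + 1) c) = vertexMap F (n + 1) c := by
    intro n n'
    by_cases hn : n ≤ n'
    · obtain ⟨m, hm⟩ := exists_anc_vertexMap F hn
      exact ⟨m, fun _ => hm⟩
    · exact ⟨0, fun h => absurd h hn⟩
  choose μ hμ using hcompat
  -- Beyond this depth the component `n` of `F` is defined and compatible with all the components `i
  -- ≤ n`: the sum dominates each `μ i n`, and the `+ 1` comes from numbering the levels from `C_1`.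
  let Ψ : ℕ → ℕ := fun k =>
    Nat.rec 0 (fun n _ => F.idx n + ∑ i ∈ Finset.range (n + 1), μ i n + 1) k
  have hΨ : ∀ n, Ψ (n + 1) = F.idx n + ∑ i ∈ Finset.range (n + 1), μ i n + 1 := fun _ => rfl
  have key := exists_properMap Ψ (vertexMap F) ?_ ?_ ?_ rfl
  · obtain ⟨f, hf⟩ := key
    refine ⟨f, fun n => ?_⟩
    obtain ⟨N, hN⟩ := hf (n + 1)
    obtain ⟨k, hk⟩ := exists_nat_ge N
    have ha : (inducedHom f).idx n ≤ (inducedHom f).idx n + F.idx n + k := by lia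
    have hb : F.idx n ≤ (inducedHom f).idx n + F.idx n + k := by lia
    refine ⟨(inducedHom f).idx n + F.idx n + k, ha, hb, ?_⟩
    ext c
    refine Subtype.ext (((induces_inducedHom f).val_app ha c).trans
      (Eq.trans ?_ (vertexMap_succ F hb c)))
    refine hN _ ?_
    have hc : (levelPoint c).height = (((inducedHom f).idx n + F.idx n + k + 1 : ℕ) : ℝ) :=
      congrArg (Nat.cast (R := ℝ))
        (Subtype.property (p := fun c : S.V => S.graph.dist S.root c = _) c)
    rw [hc]
    exact hk.trans (by exact_mod_cast (by lia))
  · rintro (_ | n) c h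
    · exact T.depth_root
    · rw [hΨ] at h
      exact depth_vertexMap F (by lia)
  · rintro (_ | j) (_ | n) c hj h
    · exact T.anc_zero _
    · exact T.anc_zero _
    · lia
    · have hjn : j ≤ n := by lia
      have h1 : μ j n ≤ ∑ i ∈ Finset.range (n + 1), μ i n :=
        Finset.single_le_sum (f := fun i => μ i n) (fun _ _ => Nat.zero_le _)
          (Finset.mem_range.2 (by lia))
      rw [hΨ] at h
      exact hμ j n hjn c (by lia)
  · rintro (_ | j) m c h hm
    · rfl
    · rw [hΨ] at h
      exact vertexMap_anc F (by lia) hm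

instance full_eta : (eta.{u}).Full where
  map_surjective {S T} := by
    rintro ⟨F⟩
    obtain ⟨f, hf⟩ := exists_inducedHom_equivalent F
    exact ⟨Quotient.mk (ProperMap.setoid S T) f,
      (eta_map_mk f (induces_inducedHom f)).trans (Quotient.sound hf)⟩

end SimplicialTree

/-! ### Trees given by a parent function -/

namespace SimpleGraph

variable {V : Type u} {par : V → V} {r : V} {d : V → ℕ}

/-- The graph in which each vertex other than the fixed points of `par` is joined to its image. -/
def ofParent (par : V → V) : SimpleGraph V where
  Adj a b := a ≠ b ∧ (par a = b ∨ par b = a)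
  symm := ⟨fun _ _ h => ⟨h.1.symm, h.2.symm⟩⟩
  loopless := ⟨fun _ h => h.1 rfl⟩

/-- Descending induction on `d` joins every vertex to `r`. For acyclicity, every edge from `a` to
`par a` is a bridge, because the vertices whose orbit under `par` meets `a` can be left only through
it. -/
lemma isTree_ofParent (hr : par r = r) (hd : ∀ a, a ≠ r → d (par a) + 1 = d a) :
    (ofParent par).IsTree := by
  have hne : ∀ a, a ≠ r → par a ≠ a := fun a ha h => by
    have := hd a ha
    rw [h] at this
    lia
  have hle : ∀ a, d (par a) ≤ d a := fun a => by
    by_cases ha : a = r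
    · rw [ha, hr]
    · exact Nat.le_of_succ_le (hd a ha).le
  have hle' : ∀ k a, d (par^[k] a) ≤ d a := by
    intro k a
    induction k with
    | zero => exact le_rfl
    | succ k ih =>
      rw [Function.iterate_succ_apply']
      exact (hle _).trans ih
  have hreach : ∀ n a, d a = n → (ofParent par).Reachable a r := by
    intro n
    induction n using Nat.strong_induction_on with
    | _ n ih =>
      intro a ha
      by_cases har : a = r
      · rw [har]
      · have h := hd a har
        have hadj : (ofParent par).Adj a (par a) := ⟨(hne a har).symm, Or.inl rfl⟩
        exact hadj.reachable.trans (ih _ (by lia) _ rfl)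
  have hbridge : ∀ a, a ≠ r → (ofParent par).IsBridge s(a, par a) := by
    intro a ha
    rw [isBridge_iff]
    -- The two conditions differ only if `x = a`, which would make this edge the deleted one.
    have step : ∀ x, s(x, par x) ≠ s(a, par a) →
        ((∃ k, par^[k] x = a) ↔ ∃ k, par^[k] (par x) = a) := by
      intro x hx
      constructor
      · rintro ⟨_ | k, h⟩
        · exact absurd (by rw [show x = a from h]) hx
        · exact ⟨k, h⟩
      · rintro ⟨k, h⟩
        exact ⟨k + 1, h⟩
    have walk : ∀ {x y}, ((ofParent par).deleteEdges {s(a, par a)}).Walk x y →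
        ((∃ k, par^[k] x = a) ↔ ∃ k, par^[k] y = a) := by
      intro x y q
      induction q with
      | nil => exact Iff.rfl
      | @cons x z y h q ih =>
        refine Iff.trans ?_ ih
        obtain ⟨⟨-, h1⟩, h2⟩ := deleteEdges_adj.1 h
        rcases h1 with rfl | rfl
        · exact step _ h2
        · exact (step _ fun h => h2 (Sym2.eq_swap.trans h)).symm
    rintro ⟨q⟩
    -- A walk around the deleted edge would put `a` in the orbit of `par a`, but `d` does not
    -- increase along orbits.
    obtain ⟨k, hk⟩ := (walk q).1 ⟨0, rfl⟩
    have h1 := hle' k (par a)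
    have h2 := hd a ha
    rw [hk] at h1
    lia
  refine ⟨?_, ?_⟩
  · have : Nonempty V := ⟨r⟩
    exact ⟨fun a b => (hreach _ a rfl).trans (hreach _ b rfl).symm⟩
  · rw [isAcyclic_iff_forall_adj_isBridge]
    rintro v w ⟨hvw, rfl | rfl⟩
    · exact hbridge v fun h => hvw (by rw [h, hr])
    · rw [Sym2.eq_swap]
      exact hbridge w fun h => hvw (by rw [h, hr])

/-- Following parents gives a walk of length `d a`; conversely `d` changes by at most one along an
edge. -/
lemma dist_ofParent (hr : par r = r) (hd : ∀ a, a ≠ r → d (par a) + 1 = d a) (h0 : d r = 0)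
    (a : V) : (ofParent par).dist r a = d a := by
  have hconn := (isTree_ofParent hr hd).connected
  have hle : ∀ n a, d a = n → (ofParent par).dist r a ≤ n := by
    intro n
    induction n with
    | zero =>
      intro a ha
      by_cases har : a = r
      · rw [har, dist_self]
      · have := hd a har
        lia
    | succ n ih =>
      intro a ha
      have har : a ≠ r := by
        rintro rfl
        lia
      have h := hd a har
      have h1 := ih (par a) (by lia)
      have hadj : (ofParent par).Adj (par a) a := ⟨fun e => by rw [e] at h; lia, Or.inr rfl⟩
      have h2 := hconn.dist_triangle (u := r) (v := par a) (w := a)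
      rw [dist_eq_one_iff_adj.2 hadj] at h2
      lia
  have hstep : ∀ x, d x ≤ d (par x) + 1 ∧ d (par x) ≤ d x + 1 := fun x => by
    by_cases h : x = r
    · rw [h, hr]
      lia
    · have := hd x h
      lia
  have hge : ∀ {x y} (q : (ofParent par).Walk x y), d y ≤ d x + q.length := by
    intro x y q
    induction q with
    | nil => exact le_rfl
    | @cons x z y h q ih =>
      rw [Walk.length_cons]
      rcases h.2 with rfl | rfl
      · have := hstep x
        lia
      · have := hstep z
        lia
  obtain ⟨q, hq⟩ := hconn.exists_walk_length_eq_dist r a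
  have := hge q
  exact le_antisymm (hle _ a rfl) (by lia)

end SimpleGraph

/-! ### Realizing an inverse sequence as the levels of a tree -/

namespace Tower

variable {C : Type u} [Category.{w} C]

/-- An isomorphism of inverse systems gives an isomorphism of inverse sequences. -/
lemma nonempty_iso_of_forall {X Y : Tower C} (e : ∀ n, X.X n ≅ Y.X n)
    (he : ∀ {n m : ℕ} (h : n ≤ m), X.p h ≫ (e n).hom = (e m).hom ≫ Y.p h) : Nonempty (X ≅ Y) := by
  let f : SeqHom X Y := ⟨fun n => n, fun n => (e n).hom, fun {n n'} h =>
    ⟨n', h, le_rfl, by rw [p_refl, Category.id_comp, he]⟩⟩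
  let g : SeqHom Y X := ⟨fun n => n, fun n => (e n).inv, fun {n n'} h =>
    ⟨n', h, le_rfl, by
      rw [p_refl, Category.id_comp, Iso.comp_inv_eq, Category.assoc, he, Iso.inv_hom_id_assoc]⟩⟩
  exact ⟨⟨Quotient.mk (SeqHom.setoid X Y) f, Quotient.mk (SeqHom.setoid Y X) g,
    Quotient.sound fun n => ⟨n, le_rfl, le_rfl, congrArg (X.p le_rfl ≫ ·) (e n).hom_inv_id⟩,
    Quotient.sound fun n => ⟨n, le_rfl, le_rfl, congrArg (Y.p le_rfl ≫ ·) (e n).inv_hom_id⟩⟩⟩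

/-! ### The tree of an inverse sequence of sets -/

variable (X : Tower (Type u))

/-- The vertices other than the root are the elements of the terms of the sequence; the parent of an
element is its image in the preceding term. -/
def treeParent : Option (Σ n, X.X n) → Option (Σ n, X.X n)
  | none => none
  | some ⟨0, _⟩ => none
  | some ⟨n + 1, x⟩ => some ⟨n, X.p (Nat.le_succ n) x⟩

/-- The depth of a vertex in the tree of an inverse sequence. -/
def treeDepth : Option (Σ n, X.X n) → ℕ
  | none => 0
  | some ⟨n, _⟩ => n + 1

lemma treeDepth_treeParent (a : Option (Σ n, X.X n)) (ha : a ≠ none) :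
    X.treeDepth (X.treeParent a) + 1 = X.treeDepth a := by
  match a, ha with
  | some ⟨0, _⟩, _ => rfl
  | some ⟨_ + 1, _⟩, _ => rfl

/-- The rooted tree of an inverse sequence of sets. -/
def tree : SimplicialTree.{u} where
  V := Option (Σ n, X.X n)
  graph := SimpleGraph.ofParent X.treeParent
  isTree := SimpleGraph.isTree_ofParent (r := none) rfl X.treeDepth_treeParent
  root := none

lemma depth_tree (a : X.tree.V) : X.tree.depth a = X.treeDepth a :=
  SimpleGraph.dist_ofParent (r := none) rfl X.treeDepth_treeParent rfl a

lemma parent_tree {a : X.tree.V} (ha : a ≠ X.tree.root) : X.tree.parent a = X.treeParent a := by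
  have h := X.treeDepth_treeParent a ha
  refine X.tree.parent_eq ⟨fun e => ?_, Or.inl rfl⟩ ?_
  · rw [← e] at h
    lia
  · exact (congrArg (· + 1) (X.depth_tree _)).trans (h.trans (X.depth_tree a).symm)

variable {X} in
/-- An element of a term of the sequence, as a vertex of the tree. -/
def treeVertex {n : ℕ} (x : X.X n) : X.tree.V := some (⟨n, x⟩ : Σ n, X.X n)

lemma depth_treeVertex {n : ℕ} (x : X.X n) : X.tree.depth (treeVertex x) = n + 1 :=
  X.depth_tree _

lemma parent_treeVertex {n : ℕ} (x : X.X (n + 1)) :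
    X.tree.parent (treeVertex x) = treeVertex (X.p (Nat.le_succ n) x) :=
  X.parent_tree (Option.some_ne_none _)

lemma anc_treeVertex {n m : ℕ} (h : n ≤ m) (x : X.X m) :
    X.tree.anc (n + 1) (treeVertex x) = treeVertex (X.p h x) := by
  induction m, h using Nat.le_induction with
  | base =>
    have h1 := X.tree.anc_self (treeVertex x)
    rw [depth_treeVertex] at h1
    rw [p_refl]
    exact h1
  | succ m h ih =>
    rw [← X.tree.anc_parent (by rw [depth_treeVertex]; lia), parent_treeVertex,
      ← X.p_comp h (Nat.le_succ m)]
    exact ih _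

/-- The terms of an inverse sequence are the levels of its tree. -/
noncomputable def levelEquiv (n : ℕ) : X.X n ≃ X.tree.Level (n + 1) :=
  Equiv.ofBijective (fun x => ⟨treeVertex x, X.depth_treeVertex x⟩) <| by
    constructor
    · intro x y h
      exact eq_of_heq (Sigma.mk.inj (Option.some.inj (congrArg Subtype.val h))).2
    · rintro ⟨a, ha⟩
      have ha' : X.treeDepth a = n + 1 := (X.depth_tree a).symm.trans ha
      -- The root is excluded, as its depth is `0` and not `n + 1`.
      match a, ha, ha' with
      | some ⟨m, x⟩, ha, ha' =>
        obtain rfl : m = n := Nat.succ_injective ha'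
        exact ⟨x, rfl⟩

lemma nonempty_levels_tree_iso : Nonempty (X.tree.levels ≅ X) := by
  suffices h : Nonempty (X ≅ X.tree.levels) from ⟨h.some.symm⟩
  refine nonempty_iso_of_forall (Y := X.tree.levels) (fun n => (X.levelEquiv n).toIso) ?_
  intro n m h
  ext x
  refine Subtype.ext ?_
  exact ((X.tree.levels_p_apply h (X.levelEquiv m x)).trans (X.anc_treeVertex h x)).symm

end Tower

/-! ### Essential surjectivity and conclusion -/

namespace SimplicialTree

instance essSurj_eta : (eta.{u}).EssSurj where
  mem_essImage X := ⟨X.tree, X.nonempty_levels_tree_iso⟩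

end SimplicialTree

theorem theorem6p2 : (SimplicialTree.eta.{u}).IsEquivalence := by
  -- The three fields are found by instance search: `faithful_eta`, `full_eta` and `essSurj_eta`.
  exact {}
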